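/- Let $k$ be an algebraically closed field of characteristic different from $2$, let $F\subset\mathbb{P}^2$ be a smooth plane cubic over $k$, and let $\beta\in\mathrm{Pic}(F)[2]$, $\beta\neq 0$. For $p\in F$ and $\gamma\in\mathrm{Pic}(F)[2]$ let $p+\gamma$ denote the unique point $q\in F$ with $[q]-[p]=\gamma$ in $\mathrm{Pic}(F)$. Let $\pi:F\to F/\beta$ be the quotient by the translation $p\mapsto p+\beta$, and let $$i':F/\beta\to(\mathbb{P}^2)^*,\qquad \{p,p+\beta\}\mapsto\overline{p\,(p+\beta)},$$ be the chord construction, with image $F'=\{\overline{p\,(p+\beta)} : p\in F\}$. Let $\beta'$ be the image in $\mathrm{Pic}(F/\beta)$ of the non-zero element of $\mathrm{Pic}(F)[2]/\langle\beta\rangle$, so that $\pi(p)+\beta'=\pi(p+\gamma)$ for any $\gamma\in\mathrm{Pic}(F)[2]\setminus\{0,\beta\}$. If $p$ is a flex of $F$, then $i'(\pi(p)+\beta')$ is a flex of $F'$; that is, $F'$ is a smooth plane cubic in $(\mathbb{P}^2)^*$ and the tangent line to $F'$ at the point $i'(\pi(p)+\beta')$ meets $F'$ there with multiplicity $3$.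 -/

import Mathlib

namespace ChordConstruction

noncomputable section

open MvPolynomial
open scoped LinearAlgebra.Projectivization

universe u

/-- Points of the projective plane over `k`. The same type, read in dual coordinates `[U;V;W]`,
is the dual plane: `[U;V;W]` is the line `U X + V Y + W Z = 0`. -/
abbrev Plane (k : Type u) [Field k] : Type u := ℙ k (Fin 3 → k)

/-- The point `P` lies on the plane curve `G = 0` (for homogeneous `G`, independent of the
representative). -/
def Vanishes {k : Type u} [Field k] (G : MvPolynomial (Fin 3) k) (P : Plane k) : Prop :=
  eval P.rep G = 0

/-- The set of points of the plane curve `G = 0`. -/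
def zeroLocus {k : Type u} [Field k] (G : MvPolynomial (Fin 3) k) : Set (Plane k) :=
  {P | Vanishes G P}

/-- `G` is an equation of a smooth plane cubic: a cubic form whose partial derivatives do not
vanish simultaneously at any point of the curve `G = 0`. -/
structure IsSmoothCubic {k : Type u} [Field k] (G : MvPolynomial (Fin 3) k) : Prop where
  homogeneous : G.IsHomogeneous 3
  smooth : ∀ v : Fin 3 → k, v ≠ 0 → eval v G = 0 → ∃ i, eval v (pderiv i G) ≠ 0

/-- The restriction of the form `G` to the line through `P` and `Q`, in the affine parameter
`t ↦ P + t Q`, which takes the value `P` at `t = 0`. -/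
def restrictToLine {k : Type u} [Field k] (G : MvPolynomial (Fin 3) k) (P Q : Plane k) :
    Polynomial k :=
  aeval (fun i => Polynomial.C (P.rep i) + Polynomial.X * Polynomial.C (Q.rep i)) G

/-- `P` is a flex of the plane curve `G = 0`: it is a smooth point of the curve, and some line
through `P` (namely the line `PQ`, which is then the tangent) meets the curve at `P` with
multiplicity at least three. -/
def IsFlex {k : Type u} [Field k] (G : MvPolynomial (Fin 3) k) (P : Plane k) : Prop :=
  Vanishes G P ∧ (∃ i, eval P.rep (pderiv i G) ≠ 0) ∧
    ∃ Q : Plane k, Q ≠ P ∧ Polynomial.X ^ 3 ∣ restrictToLine G P Q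

/-- The points of the plane curve `G = 0`, as a type. -/
abbrev Points {k : Type u} [Field k] (G : MvPolynomial (Fin 3) k) : Type u := zeroLocus G

/-! ### Divisors and the Picard group of a smooth plane curve -/

/-- The homogeneous ideal of a point of the plane. -/
def pointIdeal {k : Type u} [Field k] (P : Plane k) : Ideal (MvPolynomial (Fin 3) k) :=
  Ideal.span {f | (∃ n : ℕ, f.IsHomogeneous n) ∧ Vanishes f P}

/-- The form `A`, restricted to the curve `G = 0`, lies in the `n`-th power of the maximal ideal
of the local ring of the curve at `P`; the denominator `U` is a unit of that local ring. -/
def VanishesToOrder {k : Type u} [Field k] (G A : MvPolynomial (Fin 3) k) (P : Plane k)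
    (n : ℕ) : Prop :=
  ∃ U : MvPolynomial (Fin 3) k, eval P.rep U ≠ 0 ∧ U * A ∈ pointIdeal P ^ n ⊔ Ideal.span {G}

/-- The order of vanishing at `P` of the restriction of the form `A` to the smooth irreducible
curve `G = 0`. It is meaningful when `A` is not divisible by `G`; the set below is then finite. -/
def ord {k : Type u} [Field k] (G A : MvPolynomial (Fin 3) k) (P : Plane k) : ℕ :=
  sSup {n : ℕ | VanishesToOrder G A P n}

/-- Divisors on the curve `G = 0`: integer combinations of its points. -/
abbrev Divisor {k : Type u} [Field k] (G : MvPolynomial (Fin 3) k) : Type u := Points G →₀ ℤ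

/-- `D` is the divisor of the rational function `A / B` on the curve `G = 0`, for some forms `A`,
`B` of the same degree, neither of which vanishes identically on the curve. -/
def IsDivisorOfFunction {k : Type u} [Field k] (G : MvPolynomial (Fin 3) k) (D : Divisor G) :
    Prop :=
  ∃ (d : ℕ) (A B : MvPolynomial (Fin 3) k), A.IsHomogeneous d ∧ B.IsHomogeneous d ∧
    ¬ G ∣ A ∧ ¬ G ∣ B ∧ ∀ P : Points G, D P = (ord G A P : ℤ) - (ord G B P : ℤ)

/-- The group of principal divisors. (On a smooth cubic the divisors of rational functions already
form a subgroup, so that taking the generated subgroup adds nothing.) -/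
def principalDivisors {k : Type u} [Field k] (G : MvPolynomial (Fin 3) k) :
    AddSubgroup (Divisor G) :=
  AddSubgroup.closure {D | IsDivisorOfFunction G D}

/-- The Picard group: divisors modulo principal divisors. -/
abbrev Pic {k : Type u} [Field k] (G : MvPolynomial (Fin 3) k) : Type u :=
  Divisor G ⧸ principalDivisors G

/-- The class of the divisor `[q] - [p]`. -/
def diffClass {k : Type u} [Field k] (G : MvPolynomial (Fin 3) k) (p q : Points G) : Pic G :=
  QuotientAddGroup.mk (Finsupp.single q 1 - Finsupp.single p 1)

open Classical in
/-- The translate `p + β`: the point `q` of the curve with `[q] - [p] = β` in the Picard group.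
On a smooth plane cubic it exists and is unique for every `β` of degree zero, in particular for
every torsion class; if there were no such point, the value would be `p`. -/
def translate {k : Type u} [Field k] {G : MvPolynomial (Fin 3) k} (β : Pic G) (p : Points G) :
    Points G :=
  if h : ∃ q : Points G, diffClass G p q = β then h.choose else p

/-! ### The quotient curve and the chord construction -/

lemma diffClass_self {k : Type u} [Field k] (G : MvPolynomial (Fin 3) k) (p : Points G) :
    diffClass G p p = 0 := by
  simp [diffClass]

lemma diffClass_neg {k : Type u} [Field k] (G : MvPolynomial (Fin 3) k) (p q : Points G) :
    -diffClass G p q = diffClass G q p := by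
  simp [diffClass]

lemma diffClass_add {k : Type u} [Field k] (G : MvPolynomial (Fin 3) k) (p q r : Points G) :
    diffClass G p q + diffClass G q r = diffClass G p r := by
  simp [diffClass]

/-- Two points are identified in `F / β` when they differ by a multiple of `β`. -/
def translationSetoid {k : Type u} [Field k] {G : MvPolynomial (Fin 3) k} (β : Pic G) :
    Setoid (Points G) where
  r p q := diffClass G p q ∈ AddSubgroup.zmultiples β
  iseqv :=
    { refl := fun p => by
        rw [diffClass_self]
        exact zero_mem _
      symm := fun {p q} h => by
        rw [← diffClass_neg]
        exact neg_mem h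
      trans := fun {p q r} h₁ h₂ => by
        rw [← diffClass_add G p q r]
        exact add_mem h₁ h₂ }

/-- The quotient `F / β` of the curve `F : G = 0` by the translation by `β`. -/
abbrev QuotientCurve {k : Type u} [Field k] {G : MvPolynomial (Fin 3) k} (β : Pic G) : Type u :=
  Quotient (translationSetoid β)

/-- The quotient map `π : F → F / β`. -/
def quotientMap {k : Type u} [Field k] {G : MvPolynomial (Fin 3) k} (β : Pic G) (p : Points G) :
    QuotientCurve β :=
  Quotient.mk (translationSetoid β) p

open Classical in
/-- The line through two distinct points, as a point of the dual plane: its dual coordinates are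
the cross product of the coordinates of the two points. -/
def lineThrough {k : Type u} [Field k] (P Q : Plane k) : Plane k :=
  Projectivization.cross P Q

/-- The chord construction `i' : F / β → (ℙ²)*`, which sends `{p, p + β}` to the line through `p`
and `p + β`. (For `β` of order two the line does not depend on the representative `p`.) -/
def chordMap {k : Type u} [Field k] {G : MvPolynomial (Fin 3) k} (β : Pic G)
    (x : QuotientCurve β) : Plane k :=
  lineThrough (x.out : Plane k) (translate β x.out : Plane k)

/-- `Pic F` modulo the subgroup generated by `β`. The direct image of divisor classes along
`π : F → F / β` identifies it with the Picard group of the quotient curve: under this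
identification the class of `[π q] - [π p]` is the image of the class of `[q] - [p]`. -/
abbrev PicQuotient {k : Type u} [Field k] {G : MvPolynomial (Fin 3) k} (β : Pic G) : Type u :=
  Pic G ⧸ AddSubgroup.zmultiples β

/-- The direct image `Pic F → Pic (F / β)` of divisor classes. -/
def pushforward {k : Type u} [Field k] {G : MvPolynomial (Fin 3) k} (β γ : Pic G) :
    PicQuotient β :=
  QuotientAddGroup.mk γ

open Classical in
/-- The translate `x + β'` of a point `x` of `F / β` by a class `β'`: the point `y` of `F / β`
such that the class of `[y] - [x]` is `β'`. If there were no such point, the value would be `x`. -/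
def quotientTranslate {k : Type u} [Field k] {G : MvPolynomial (Fin 3) k} (β : Pic G)
    (β' : PicQuotient β) (x : QuotientCurve β) : QuotientCurve β :=
  if h : ∃ y : QuotientCurve β, ∃ p q : Points G,
      quotientMap β p = x ∧ quotientMap β q = y ∧ pushforward β (diffClass G p q) = β' then
    h.choose
  else x

end

end ChordConstruction

/-! The flex `p` is taken as the origin `O` of the group law. A smooth cubic with a flex has, after
a linear change of coordinates, a Weierstrass equation with the flex at infinity
(`exists_weierstrass`). The class `β` is then `[B] - [O]` for an affine point `B` with `y = 0`, and
moving `B` to the origin of the affine plane gives `y² = x (x² + a x + b)` with `b ≠ 0` and `a² ≠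
4b`. The line through `(x, y)` and `B` shows that translation by `β` is `(x, y) ↦ (b/x, -b y/x²)`.

Eliminating `(x, y)` from the two incidence conditions, the chords `U X + V Y + W Z = 0` are exactly
the zeros of `W³ - 2b² U V² - b W U² + a b W V²` (`chordCubic`), which is smooth because `b (a² -
4b) ≠ 0`. The point `π(O) + β'` is `π(T)` for another point `T = (t, 0)` of order two. Its translate
is `(b/t, 0)`, so the chord is `Y = 0`, the dual point `[0;1;0]`. The tangent there has direction
`(a, 0, 2b)`, and along it the cubic restricts to a multiple of the third power of the parameter
(`isFlex_chordCubic`).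

The rest justifies the use of the group law, since translates are chosen by their classes in `Pic`.
Two facts are needed: a point is determined by its class (`IsWeierstrass.diffClass_injective`), and
a class killed by two is `[S] - [O]` with `S = O` or `y(S) = 0` (`IsInfinity.exists_two_torsion`).
Both follow from `IsInfinity.eq_of_principal`: if `[S] + n[O]` is principal, then `S = O` and `n =
-1`. This is reduced by Max Noether's theorem (`IsWeierstrass.exists_eq_mul`) to the fact that a
line tangent at `O` cuts out `3[O]`. Relations in `Pic` come from lines, whose divisors `ord_line`
computes from local uniformizers. -/

namespace ChordConstruction

noncomputable section

open MvPolynomial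
open scoped LinearAlgebra.Projectivization Matrix

universe u

variable {k : Type u} [Field k]

/-! ### Linear forms and linear substitutions -/

/-- The linear form with coefficients `c`. -/
def linForm (c : Fin 3 → k) : MvPolynomial (Fin 3) k := ∑ i, C (c i) * X i

lemma linForm_isHomogeneous (c : Fin 3 → k) : (linForm c).IsHomogeneous 1 :=
  IsHomogeneous.sum _ _ _ fun i _ => isHomogeneous_C_mul_X (c i) i

@[simp] lemma eval_linForm (c v : Fin 3 → k) : eval v (linForm c) = c ⬝ᵥ v := by
  simp [linForm, dotProduct]

@[simp] lemma pderiv_linForm (c : Fin 3 → k) (i : Fin 3) : pderiv i (linForm c) = C (c i) := by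
  fin_cases i <;> simp [linForm, Fin.sum_univ_three, pderiv_X]

/-- The substitution of the linear forms with coefficients the rows of `M`. -/
def subst (M : Matrix (Fin 3) (Fin 3) k) : MvPolynomial (Fin 3) k →ₐ[k] MvPolynomial (Fin 3) k :=
  aeval fun i => linForm (M i)

@[simp] lemma subst_X (M : Matrix (Fin 3) (Fin 3) k) (i : Fin 3) :
    subst M (X i) = linForm (M i) := by
  simp [subst]

@[simp] lemma subst_C (M : Matrix (Fin 3) (Fin 3) k) (a : k) : subst M (C a) = C a := by
  simp [subst]

lemma eval_subst (M : Matrix (Fin 3) (Fin 3) k) (H : MvPolynomial (Fin 3) k) (v : Fin 3 → k) :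
    eval v (subst M H) = eval (M *ᵥ v) H := by
  have : (aeval v : MvPolynomial (Fin 3) k →ₐ[k] k).comp (subst M) = aeval (M *ᵥ v) := by
    ext i
    simp [Matrix.mulVec, aeval_eq_eval]
  simpa [aeval_eq_eval] using DFunLike.congr_fun this H

lemma subst_linForm (M : Matrix (Fin 3) (Fin 3) k) (c : Fin 3 → k) :
    subst M (linForm c) = linForm (c ᵥ* M) := by
  simp only [linForm, map_sum, map_mul, subst_C, subst_X, Matrix.vecMul, dotProduct,
    Finset.mul_sum, Finset.sum_mul]
  rw [Finset.sum_comm]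
  refine Finset.sum_congr rfl fun i _ => Finset.sum_congr rfl fun j _ => ?_
  exact (mul_assoc _ _ _).symm

lemma subst_subst (M N : Matrix (Fin 3) (Fin 3) k) (H : MvPolynomial (Fin 3) k) :
    subst M (subst N H) = subst (N * M) H := by
  have : (subst M).comp (subst N) = subst (N * M) := by
    ext1 i
    simp only [AlgHom.comp_apply, subst_X, subst_linForm]
    congr 1
  exact DFunLike.congr_fun this H

@[simp] lemma subst_one (H : MvPolynomial (Fin 3) k) : subst 1 H = H := by
  have : subst (1 : Matrix (Fin 3) (Fin 3) k) = AlgHom.id _ _ := by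
    ext1 i
    simp [linForm, Matrix.one_apply]
  rw [this, AlgHom.id_apply]

lemma subst_isHomogeneous (M : Matrix (Fin 3) (Fin 3) k) {H : MvPolynomial (Fin 3) k} {n : ℕ}
    (hH : H.IsHomogeneous n) : (subst M H).IsHomogeneous n := by
  have := hH.aeval _ fun i => linForm_isHomogeneous (M i)
  rwa [one_mul] at this

lemma pderiv_subst (M : Matrix (Fin 3) (Fin 3) k) (H : MvPolynomial (Fin 3) k) (i : Fin 3) :
    pderiv i (subst M H) = ∑ j, C (M j i) * subst M (pderiv j H) := by
  induction H using MvPolynomial.induction_on with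
  | C a => simp
  | add p q hp hq => simp [hp, hq, mul_add, Finset.sum_add_distrib]
  | mul_X p j hp =>
    have hX : ∑ l, C (M l i) * subst M (p * pderiv l (X j)) = C (M j i) * subst M p := by
      rw [Finset.sum_eq_single j]
      · rw [pderiv_X_self, mul_one]
      · intro l _ hl
        rw [pderiv_X_of_ne hl.symm, mul_zero, map_zero, mul_zero]
      · simp
    rw [map_mul, pderiv_mul, hp, subst_X, pderiv_linForm, Finset.sum_mul]
    simp only [pderiv_mul, map_add, mul_add, Finset.sum_add_distrib, hX, map_mul (subst M)
      (pderiv _ p), subst_X, ← mul_assoc]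
    rw [mul_comm (subst M p)]

/-- The substitution of an invertible matrix, as an automorphism. -/
def substEquiv (M : Matrix (Fin 3) (Fin 3) k) (hM : IsUnit M.det) :
    MvPolynomial (Fin 3) k ≃ₐ[k] MvPolynomial (Fin 3) k :=
  AlgEquiv.ofAlgHom (subst M) (subst M⁻¹)
    (by ext1 i; simp [AlgHom.comp_apply, -subst_X, subst_subst, Matrix.nonsing_inv_mul M hM])
    (by ext1 i; simp [AlgHom.comp_apply, -subst_X, subst_subst, Matrix.mul_nonsing_inv M hM])

@[simp] lemma substEquiv_apply (M : Matrix (Fin 3) (Fin 3) k) (hM : IsUnit M.det)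
    (H : MvPolynomial (Fin 3) k) : substEquiv M hM H = subst M H := rfl

lemma mulVec_ne_zero {M : Matrix (Fin 3) (Fin 3) k} (hM : IsUnit M.det) {v : Fin 3 → k}
    (hv : v ≠ 0) : M *ᵥ v ≠ 0 := fun h => hv <| by
  simpa [Matrix.mulVec_mulVec, Matrix.nonsing_inv_mul M hM] using congrArg (M⁻¹ *ᵥ ·) h

/-- By the chain rule the gradient of `subst M H` at `v` is `Mᵀ` applied to the gradient of `H` at
`M v`, and both matrices are invertible. -/
lemma IsSmoothCubic.subst {H : MvPolynomial (Fin 3) k} (hH : IsSmoothCubic H)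
    {M : Matrix (Fin 3) (Fin 3) k} (hM : IsUnit M.det) : IsSmoothCubic (subst M H) where
  homogeneous := subst_isHomogeneous M hH.homogeneous
  smooth v hv h0 := by
    rw [eval_subst] at h0
    by_contra! hc
    obtain ⟨j, hj⟩ := hH.smooth _ (mulVec_ne_zero hM hv) h0
    have hz : Mᵀ *ᵥ (fun j => eval (M *ᵥ v) (pderiv j H)) = 0 := by
      ext i
      have := hc i
      rw [pderiv_subst] at this
      simpa [eval_subst, Matrix.mulVec, dotProduct] using this
    have : (fun j => eval (M *ᵥ v) (pderiv j H)) ≠ 0 := fun h => hj (congrFun h j)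
    exact mulVec_ne_zero (M := Mᵀ) (by simpa using hM) this hz

/-- Induction on forms in three variables. -/
lemma homogeneous_induction {n : ℕ} {p : MvPolynomial (Fin 3) k → Prop}
    (hadd : ∀ A B, p A → p B → p (A + B)) (h0 : p 0)
    (hmon : ∀ (r : k) (i j l : ℕ), i + j + l = n → p (C r * (X 0 ^ i * X 1 ^ j * X 2 ^ l)))
    {A : MvPolynomial (Fin 3) k} (hA : A.IsHomogeneous n) : p A := by
  rw [A.as_sum]
  refine Finset.sum_induction _ p hadd h0 fun d hd => ?_
  have hdeg : d 0 + d 1 + d 2 = n := by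
    have := hA (mem_support_iff.1 hd)
    rw [Finsupp.weight_apply, Finsupp.sum_fintype _ _ (by simp)] at this
    simpa [Fin.sum_univ_three] using this
  rw [monomial_eq, Finsupp.prod_fintype _ _ (by simp), Fin.prod_univ_three]
  exact hmon _ _ _ _ hdeg

/-! ### Weierstrass cubics -/

/-- The Weierstrass cubic `Y²Z - (X³ + a X²Z + b XZ² + c Z³)`. -/
def weierstrass (a b c : k) : MvPolynomial (Fin 3) k :=
  X 1 ^ 2 * X 2 - (X 0 ^ 3 + C a * (X 0 ^ 2 * X 2) + C b * (X 0 * X 2 ^ 2) + C c * X 2 ^ 3)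

/-- The monomials divisible by `Z` are grouped, so that restriction to the line `Z = 0` keeps just
`c₀, c₁, c₂, c₃`. -/
lemma exists_cubic_coeffs {H : MvPolynomial (Fin 3) k} (hH : H.IsHomogeneous 3) :
    ∃ c₀ c₁ c₂ c₃ c₄ c₅ c₆ c₇ c₈ c₉ : k,
      H = C c₀ * X 0 ^ 3 + C c₁ * (X 0 ^ 2 * X 1) + C c₂ * (X 0 * X 1 ^ 2) + C c₃ * X 1 ^ 3 +
        X 2 * (C c₄ * X 0 ^ 2 + C c₅ * (X 0 * X 1) + C c₆ * X 1 ^ 2 + C c₇ * (X 0 * X 2) +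
          C c₈ * (X 1 * X 2) + C c₉ * X 2 ^ 2) := by
  refine homogeneous_induction (p := fun H => ∃ c₀ c₁ c₂ c₃ c₄ c₅ c₆ c₇ c₈ c₉ : k,
      H = C c₀ * X 0 ^ 3 + C c₁ * (X 0 ^ 2 * X 1) + C c₂ * (X 0 * X 1 ^ 2) + C c₃ * X 1 ^ 3 +
        X 2 * (C c₄ * X 0 ^ 2 + C c₅ * (X 0 * X 1) + C c₆ * X 1 ^ 2 + C c₇ * (X 0 * X 2) +
          C c₈ * (X 1 * X 2) + C c₉ * X 2 ^ 2)) ?_ ?_ ?_ hH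
  · intro A B hA hB
    obtain ⟨c₀, c₁, c₂, c₃, c₄, c₅, c₆, c₇, c₈, c₉, rfl⟩ := hA
    obtain ⟨d₀, d₁, d₂, d₃, d₄, d₅, d₆, d₇, d₈, d₉, rfl⟩ := hB
    refine ⟨c₀ + d₀, c₁ + d₁, c₂ + d₂, c₃ + d₃, c₄ + d₄, c₅ + d₅, c₆ + d₆, c₇ + d₇, c₈ + d₈,
      c₉ + d₉, ?_⟩
    simp only [C_add]
    ring
  · exact ⟨0, 0, 0, 0, 0, 0, 0, 0, 0, 0, by simp⟩
  · intro r i j l h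
    have hi : i ≤ 3 := by omega
    have hj : j ≤ 3 := by omega
    obtain rfl : l = 3 - i - j := by omega
    interval_cases i <;> interval_cases j <;> first | omega | skip
    · exact ⟨0, 0, 0, 0, 0, 0, 0, 0, 0, r, by simp; ring⟩
    · exact ⟨0, 0, 0, 0, 0, 0, 0, 0, r, 0, by simp; ring⟩
    · exact ⟨0, 0, 0, 0, 0, 0, r, 0, 0, 0, by simp; ring⟩
    · exact ⟨0, 0, 0, r, 0, 0, 0, 0, 0, 0, by simp⟩
    · exact ⟨0, 0, 0, 0, 0, 0, 0, r, 0, 0, by simp; ring⟩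
    · exact ⟨0, 0, 0, 0, 0, r, 0, 0, 0, 0, by simp; ring⟩
    · exact ⟨0, 0, r, 0, 0, 0, 0, 0, 0, 0, by simp⟩
    · exact ⟨0, 0, 0, 0, r, 0, 0, 0, 0, 0, by simp; ring⟩
    · exact ⟨0, r, 0, 0, 0, 0, 0, 0, 0, 0, by simp⟩
    · exact ⟨r, 0, 0, 0, 0, 0, 0, 0, 0, 0, by simp⟩

lemma exists_frame {P Q : Plane k} (hPQ : Q ≠ P) :
    ∃ E : Matrix (Fin 3) (Fin 3) k, IsUnit E.det ∧ E *ᵥ ![1, 0, 0] = Q.rep ∧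
      E *ᵥ ![0, 1, 0] = P.rep := by
  have hcr : crossProduct Q.rep P.rep ≠ 0 := fun h => hPQ <| by
    simpa using (Projectivization.mk_eq_mk_iff_crossProduct_eq_zero Q.rep_nonzero
      P.rep_nonzero).2 h
  obtain ⟨i, hi⟩ := Function.ne_iff.1 hcr
  -- The determinant is the `i`-th coordinate of the cross product, which was chosen to be nonzero.
  refine ⟨(Matrix.of ![Q.rep, P.rep, Pi.single i 1])ᵀ, ?_, ?_, ?_⟩
  · rw [Matrix.det_transpose, isUnit_iff_ne_zero]
    fin_cases i <;> simp [Matrix.det_fin_three, cross_apply, sub_eq_zero] at hi ⊢ <;>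
      contrapose! hi <;> linear_combination hi
  · ext j
    simp [Matrix.mulVec, dotProduct, Fin.sum_univ_three]
  · ext j
    simp [Matrix.mulVec, dotProduct, Fin.sum_univ_three]

/-- A smooth cubic with a flex has a Weierstrass equation in which the flex is at infinity. -/
theorem exists_weierstrass [IsAlgClosed k] (h2 : (2 : k) ≠ 0) {G : MvPolynomial (Fin 3) k}
    (hG : IsSmoothCubic G) {P : Plane k} (hP : IsFlex G P) :
    ∃ (M : Matrix (Fin 3) (Fin 3) k) (a b c : k), IsUnit M.det ∧
      G = subst M (weierstrass a b c) ∧ (M *ᵥ P.rep) 0 = 0 ∧ (M *ᵥ P.rep) 2 = 0 := by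
  obtain ⟨_, _, Q, hQP, hdvd⟩ := hP
  obtain ⟨E, hE, hEQ, hEP⟩ := exists_frame hQP
  have hH := hG.subst hE
  -- In the frame `E` the line `PQ` is `Z = 0`, the flex is `(0, 1, 0)`, and the parametrization is
  -- `t ↦ (t, 1, 0)`.
  have hline : restrictToLine G P Q = aeval ![Polynomial.X, 1, 0] (subst E G) := by
    have : (aeval ![Polynomial.X, 1, 0] : MvPolynomial (Fin 3) k →ₐ[k] Polynomial k).comp
        (subst E) = aeval fun i =>
          Polynomial.C (P.rep i) + Polynomial.X * Polynomial.C (Q.rep i) := by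
      ext1 i
      simp only [AlgHom.comp_apply, subst_X, aeval_X, ← hEQ, ← hEP]
      simp [linForm, Fin.sum_univ_three, Matrix.mulVec, dotProduct]
      ring
    rw [restrictToLine, ← this, AlgHom.comp_apply]
  obtain ⟨c₀, c₁, c₂, c₃, c₄, c₅, c₆, c₇, c₈, c₉, hc⟩ := exists_cubic_coeffs hH.homogeneous
  rw [hline, hc, Polynomial.X_pow_dvd_iff] at hdvd
  have h3 : c₃ = 0 := by simpa [Polynomial.coeff_X, Polynomial.coeff_X_pow] using hdvd 0 (by simp)
  have h2' : c₂ = 0 := by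
    simpa [h3, Polynomial.coeff_X, Polynomial.coeff_X_pow] using hdvd 1 (by simp)
  have h1 : c₁ = 0 := by
    simpa [h3, h2', Polynomial.coeff_X, Polynomial.coeff_X_pow] using hdvd 2 (by simp)
  subst h1 h2' h3
  have hsm := hH.smooth
  rw [hc] at hsm
  have h6 : c₆ ≠ 0 := by
    rintro rfl
    obtain ⟨i, hi⟩ := hsm ![0, 1, 0] (by simp) (by simp)
    fin_cases i <;> simp [pderiv_X] at hi
  -- If `c₀ = 0`, the cubic is the line `Z = 0` together with a conic, and is singular where the two
  -- meet.
  have h0 : c₀ ≠ 0 := by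
    rintro rfl
    obtain ⟨y, hy⟩ := IsAlgClosed.exists_root
      (Polynomial.C c₆ * Polynomial.X ^ 2 + Polynomial.C c₅ * Polynomial.X + Polynomial.C c₄)
      (by rw [Polynomial.degree_quadratic h6]; simp)
    simp at hy
    obtain ⟨i, hi⟩ := hsm ![1, y, 0] (by simp) (by simp)
    fin_cases i <;> simp [pderiv_X] at hi
    exact hi (by linear_combination hy)
  obtain ⟨l, hl⟩ := IsAlgClosed.exists_pow_nat_eq (-c₀) (n := 3) (by simp)
  obtain ⟨m, hm⟩ := IsAlgClosed.exists_pow_nat_eq c₆ (n := 2) (by simp)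
  have hl0 : l ≠ 0 := by rintro rfl; simp at hl; exact h0 hl
  have hm0 : m ≠ 0 := by rintro rfl; simp at hm; exact h6 hm.symm
  subst hm
  obtain rfl : c₀ = - l ^ 3 := by rw [hl]; ring
  -- The second row completes the square in `Y`; the scalings `l` and `m` normalize the coefficients
  -- of `X³` and `Y² Z`.
  set N : Matrix (Fin 3) (Fin 3) k := !![l, 0, 0; c₅ / (2 * m), m, c₈ / (2 * m); 0, 0, 1] with hN
  have hNdet : IsUnit N.det := by
    rw [isUnit_iff_ne_zero, hN, Matrix.det_fin_three]
    simp [hl0, hm0]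
  have hW : subst N (weierstrass (((c₅ / (2 * m)) ^ 2 - c₄) / l ^ 2)
      ((2 * (c₅ / (2 * m)) * (c₈ / (2 * m)) - c₇) / l) ((c₈ / (2 * m)) ^ 2 - c₉)) =
        subst E G := by
    have e5 : c₅ = 2 * (c₅ / (2 * m)) * m := by field_simp
    have e8 : c₈ = 2 * (c₈ / (2 * m)) * m := by field_simp
    rw [hc, hN]
    conv_rhs => rw [e5, e8]
    generalize c₅ / (2 * m) = s
    generalize c₈ / (2 * m) = t
    obtain ⟨a, rfl⟩ : ∃ a, c₄ = s ^ 2 - a * l ^ 2 := ⟨(s ^ 2 - c₄) / l ^ 2, by field_simp; ring⟩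
    obtain ⟨b, rfl⟩ : ∃ b, c₇ = 2 * s * t - b * l := ⟨(2 * s * t - c₇) / l, by field_simp; ring⟩
    have ha : (s ^ 2 - (s ^ 2 - a * l ^ 2)) / l ^ 2 = a := by field_simp; ring
    have hb : (2 * s * t - (2 * s * t - b * l)) / l = b := by field_simp; ring
    rw [ha, hb]
    have hC2 : (C 2 : MvPolynomial (Fin 3) k) = 2 := map_ofNat C 2
    simp [weierstrass, linForm, Fin.sum_univ_three, hC2]
    ring
  have hP' : (N * E⁻¹) *ᵥ P.rep = ![0, m, 0] := by
    rw [← hEP, Matrix.mulVec_mulVec, Matrix.mul_assoc, Matrix.nonsing_inv_mul E hE, mul_one]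
    ext i
    fin_cases i <;> simp [hN, Matrix.mulVec, dotProduct, Fin.sum_univ_three]
  refine ⟨N * E⁻¹, ((c₅ / (2 * m)) ^ 2 - c₄) / l ^ 2,
    (2 * (c₅ / (2 * m)) * (c₈ / (2 * m)) - c₇) / l, (c₈ / (2 * m)) ^ 2 - c₉, ?_, ?_,
    congrFun hP' 0, congrFun hP' 2⟩
  · rw [Matrix.det_mul]
    exact hNdet.mul ((Matrix.isUnit_nonsing_inv_det_iff).2 hE)
  · rw [← subst_subst, hW, subst_subst, Matrix.mul_nonsing_inv E hE, subst_one]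

/-- Eisenstein's criterion at the line at infinity. -/
lemma prime_weierstrass (a b c : k) : Prime (weierstrass a b c) := by
  obtain ⟨A, hA⟩ : ∃ A : MvPolynomial (Fin 2) k, A = C a * X 1 := ⟨_, rfl⟩
  obtain ⟨B, hB⟩ : ∃ B : MvPolynomial (Fin 2) k, B = C b * X 1 ^ 2 := ⟨_, rfl⟩
  obtain ⟨D, hD⟩ : ∃ D : MvPolynomial (Fin 2) k, D = C c * X 1 ^ 3 - X 0 ^ 2 * X 1 := ⟨_, rfl⟩
  -- The cubic, up to sign, as a monic polynomial in `X` over `k[Y, Z]`; in `Fin 2` the variables `X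
  -- 0` and `X 1` stand for `Y` and `Z`. The prime for Eisenstein's criterion is `Z`.
  set f : Polynomial (MvPolynomial (Fin 2) k) := Polynomial.X ^ 3 +
    Polynomial.C A * Polynomial.X ^ 2 + Polynomial.C B * Polynomial.X + Polynomial.C D with hf
  have hW : finSuccEquiv k 2 (weierstrass a b c) = -f := by
    have e1 : finSuccEquiv k 2 (X 1) = Polynomial.C (X 0) := finSuccEquiv_X_succ (j := 0)
    have e2 : finSuccEquiv k 2 (X 2) = Polynomial.C (X 1) := finSuccEquiv_X_succ (j := 1)
    have eC : ∀ r, finSuccEquiv k 2 (C r) = Polynomial.C (C r) := fun r =>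
      (AlgEquiv.symm_apply_eq _).1 (DFunLike.congr_fun (finSuccEquiv_comp_C_eq_C 2) r) |>.symm
    simp only [weierstrass, map_sub, map_mul, map_pow, map_add, e1, e2, eC, finSuccEquiv_X_zero,
      hf, hA, hB, hD]
    ring
  have hmon : f.Monic := by
    rw [hf]
    monicity!
  have hdeg : f.natDegree = 3 := by
    rw [hf]
    compute_degree!
  have hX : Prime (X 1 : MvPolynomial (Fin 2) k) := X_prime
  have hirr : Irreducible f := by
    refine Polynomial.irreducible_of_eisenstein_criterion (P := Ideal.span {X 1})
      ((Ideal.span_singleton_prime hX.ne_zero).2 hX) ?_ ?_ ?_ ?_ hmon.isPrimitive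
    · rw [hmon.leadingCoeff, Ideal.mem_span_singleton]
      exact fun h => hX.not_isUnit (isUnit_of_dvd_one h)
    · intro n hn
      rw [Polynomial.degree_eq_natDegree hmon.ne_zero, hdeg] at hn
      have hn : n < 3 := by exact_mod_cast hn
      rw [Ideal.mem_span_singleton]
      interval_cases n
      · have : f.coeff 0 = D := by simp [hf]
        rw [this, hD]
        exact ⟨C c * X 1 ^ 2 - X 0 ^ 2, by ring⟩
      · have : f.coeff 1 = B := by simp [hf, Polynomial.coeff_C]
        rw [this, hB]
        exact ⟨C b * X 1, by ring⟩
      · have : f.coeff 2 = A := by simp [hf]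
        rw [this, hA]
        exact ⟨C a, by ring⟩
    · rw [Polynomial.degree_eq_natDegree hmon.ne_zero, hdeg]
      simp
    · have h0 : f.coeff 0 = D := by simp [hf]
      rw [Ideal.span_singleton_pow, Ideal.mem_span_singleton, h0, hD]
      rintro ⟨g, hg⟩
      have : X 0 ^ 2 = X 1 * (C c * X 1 - g : MvPolynomial (Fin 2) k) := by
        refine mul_right_cancel₀ hX.ne_zero ?_
        linear_combination -hg
      -- At `Y = 1`, `Z = 0` the identity reads `1 = 0`.
      simpa using congrArg (eval ![1, 0]) this
  rw [← MulEquiv.prime_iff (finSuccEquiv k 2).toMulEquiv]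
  have : (finSuccEquiv k 2).toMulEquiv (weierstrass a b c) = -f := hW
  rw [this]
  exact hirr.prime.neg

/-! ### Homogeneous components -/

lemma homogeneousComponent_mul {σ : Type*} {a : ℕ} {A : MvPolynomial σ k} (hA : A.IsHomogeneous a)
    (W : MvPolynomial σ k) (n : ℕ) :
    homogeneousComponent n (A * W) = if a ≤ n then A * homogeneousComponent (n - a) W else 0 := by
  have key : ∀ i, homogeneousComponent n (A * homogeneousComponent i W) =
      if a + i = n then A * homogeneousComponent i W else 0 := fun i => by
    rw [homogeneousComponent_of_mem (hA.mul (homogeneousComponent_isHomogeneous i W))]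
    simp only [eq_comm]
  conv_lhs => rw [← sum_homogeneousComponent W, Finset.mul_sum, map_sum]
  simp only [key]
  split_ifs with h
  · by_cases hn : n - a < W.totalDegree + 1
    · rw [Finset.sum_eq_single (n - a), if_pos (by omega)]
      · intro b _ hb
        rw [if_neg (by omega)]
      · intro hb
        exact absurd (Finset.mem_range.2 hn) hb
    · rw [homogeneousComponent_eq_zero _ _ (by omega), mul_zero]
      refine Finset.sum_eq_zero fun i hi => if_neg ?_
      have := Finset.mem_range.1 hi
      omega
  · exact Finset.sum_eq_zero fun i _ => if_neg (by omega)

lemma exists_eval_homogeneousComponent_ne_zero {σ : Type*} {v : σ → k} {U : MvPolynomial σ k}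
    (hU : eval v U ≠ 0) : ∃ e, eval v (homogeneousComponent e U) ≠ 0 := by
  by_contra! h
  refine hU ?_
  rw [← sum_homogeneousComponent U, map_sum]
  exact Finset.sum_eq_zero fun i _ => h i

/-- A relation `U A ≡ V B` modulo a form, between forms `A` and `B`, may be taken homogeneous. -/
lemma exists_homogeneous_relation {σ : Type*} {a b c : ℕ} {G A B U V : MvPolynomial σ k}
    (hG : G.IsHomogeneous c) (hA : A.IsHomogeneous a) (hB : B.IsHomogeneous b) {v : σ → k}
    (hU : eval v U ≠ 0) (h : G ∣ U * A - V * B) :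
    ∃ (e : ℕ) (U' V' : MvPolynomial σ k), U'.IsHomogeneous e ∧ V'.IsHomogeneous (e + a - b) ∧
      eval v U' ≠ 0 ∧ G ∣ U' * A - V' * B := by
  obtain ⟨e, he⟩ := exists_eval_homogeneousComponent_ne_zero hU
  obtain ⟨W, hW⟩ := h
  have := congrArg (homogeneousComponent (e + a)) hW
  rw [map_sub, mul_comm U, mul_comm V, homogeneousComponent_mul hA, homogeneousComponent_mul hB,
    homogeneousComponent_mul hG, if_pos (Nat.le_add_left a e), Nat.add_sub_cancel] at this
  -- When `e + a < b` the term in `B` has no component of degree `e + a`, and the truncated exponent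
  -- is harmless because `V' = 0`.
  refine ⟨e, homogeneousComponent e U, if b ≤ e + a then homogeneousComponent (e + a - b) V else 0,
    homogeneousComponent_isHomogeneous e U, ?_, he, ?_⟩
  · split_ifs
    · exact homogeneousComponent_isHomogeneous _ V
    · exact isHomogeneous_zero _ _ _
  · have h' : homogeneousComponent e U * A -
        (if b ≤ e + a then homogeneousComponent (e + a - b) V else 0) * B =
        if c ≤ e + a then G * homogeneousComponent (e + a - c) W else 0 := by
      rw [← this, mul_comm A]
      congr 1
      split_ifs
      · exact mul_comm _ _
      · exact zero_mul _
    rw [h']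
    split_ifs
    · exact dvd_mul_right _ _
    · exact dvd_zero _

lemma not_dvd_of_degree_lt {σ : Type*} {n m : ℕ} {G A : MvPolynomial σ k} (hG : G.IsHomogeneous n)
    (hA : A.IsHomogeneous m) (hA0 : A ≠ 0) (h : m < n) : ¬ G ∣ A := by
  rintro ⟨W, rfl⟩
  have hG0 := left_ne_zero_of_mul hA0
  have := totalDegree_mul_of_isDomain hG0 (right_ne_zero_of_mul hA0)
  rw [hA.totalDegree hA0, hG.totalDegree hG0] at this
  omega

/-- The values lie in an arbitrary algebra because `exists_isUniformizer` applies this in a quotient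
of the polynomial ring, with the class of a variable as scalar. -/
lemma aeval_smul_of_isHomogeneous {R : Type*} [CommRing R] [Algebra k R] {n : ℕ}
    {A : MvPolynomial (Fin 3) k} (hA : A.IsHomogeneous n) (r : R) (g : Fin 3 → R) :
    aeval (fun j => r * g j) A = r ^ n * aeval g A := by
  refine homogeneous_induction (p := fun A => aeval (fun j => r * g j) A = r ^ n * aeval g A)
    ?_ ?_ ?_ hA
  · intro A B hA hB
    rw [map_add, hA, hB, map_add, mul_add]
  · simp
  · rintro c i j l rfl
    simp only [map_mul, map_pow, aeval_X, algHom_C]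
    ring

lemma eval_smul_of_isHomogeneous {n : ℕ} {A : MvPolynomial (Fin 3) k} (hA : A.IsHomogeneous n)
    (r : k) (v : Fin 3 → k) : eval (r • v) A = r ^ n * eval v A := by
  have := aeval_smul_of_isHomogeneous hA r v
  rwa [aeval_eq_eval, aeval_eq_eval] at this

/-! ### Uniformizers -/

variable {G : MvPolynomial (Fin 3) k}

/-- Homogeneous coordinates of a point of a plane curve. -/
abbrev Points.vec (P : Points G) : Fin 3 → k := (P : Plane k).rep

lemma eval_vec_eq_of_dvd {A B : MvPolynomial (Fin 3) k} (h : G ∣ A - B) (P : Points G) :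
    eval P.vec A = eval P.vec B := by
  obtain ⟨W, hW⟩ := h
  have h0 : eval P.vec G = 0 := P.2
  rw [← sub_eq_zero, ← map_sub, hW, map_mul, h0, zero_mul]

lemma mem_pointIdeal {P : Plane k} {n : ℕ} {A : MvPolynomial (Fin 3) k} (hA : A.IsHomogeneous n)
    (h : eval P.rep A = 0) : A ∈ pointIdeal P :=
  Ideal.subset_span ⟨⟨n, hA⟩, h⟩

/-- The linear form `t` is a uniformizer of the curve `G = 0` at `P`. -/
structure IsUniformizer (P : Points G) (t : MvPolynomial (Fin 3) k) : Prop where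
  homogeneous : t.IsHomogeneous 1
  vanishes : eval P.vec t = 0
  not_dvd : ¬ G ∣ t
  generates : ∀ f ∈ pointIdeal (P : Plane k), ∃ U V : MvPolynomial (Fin 3) k,
    eval P.vec U ≠ 0 ∧ G ∣ U * f - V * t

/-- The forms `l j` generate, up to powers of the scalar `v i`, all forms vanishing at `P`. Writing
`G` in terms of them, smoothness makes some coefficient `g a` nonzero at `P`, so on the curve `l a`
is locally a multiple of the other form `l b`, which is therefore a uniformizer. -/
lemma exists_isUniformizer (hG : IsSmoothCubic G) (P : Points G) : ∃ t, IsUniformizer P t := by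
  obtain ⟨i, hi⟩ := Function.ne_iff.1 (P : Plane k).rep_nonzero
  set v := P.vec with hv
  have hi : v i ≠ 0 := hi
  set l : Fin 3 → MvPolynomial (Fin 3) k := fun j => C (v i) * X j - C (v j) * X i with hl
  have hlv : ∀ j, eval v (l j) = 0 := fun j => by simp [hl, mul_comm]
  have hspan : ∀ (n : ℕ) (A : MvPolynomial (Fin 3) k), A.IsHomogeneous n → eval v A = 0 →
      ∃ h : Fin 3 → MvPolynomial (Fin 3) k, C (v i ^ n) * A = ∑ j, h j * l j := by
    intro n A hA h0
    have hq : Ideal.Quotient.mkₐ k (Ideal.span (Set.range l)) (C (v i ^ n) * A) = 0 := by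
      -- Modulo the `l j` one has `v i · X j = v j · X i`, whence `(v i)ⁿ A(X) = A(v i · X) = A(X i
      -- · v) = (X i)ⁿ A(v) = 0`.
      set q := Ideal.Quotient.mkₐ k (Ideal.span (Set.range l))
      have hX : ∀ j, q (C (v i)) * q (X j) = q (X i) * q (C (v j)) := fun j => by
        rw [← map_mul, ← map_mul, ← sub_eq_zero, ← map_sub]
        refine Ideal.Quotient.eq_zero_iff_mem.2 ?_
        rw [mul_comm (X i)]
        exact Ideal.subset_span ⟨j, rfl⟩
      have e1 : aeval (fun j => q (X j)) A = q A := by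
        have : aeval (fun j => q (X j)) = q := by
          ext1 j
          simp
        rw [this]
      have e2 : aeval (fun j => q (C (v j))) A = q (C (eval v A)) := by
        have : (aeval (fun j => q (C (v j))) : MvPolynomial (Fin 3) k →ₐ[k] _) =
            (q.comp (Algebra.ofId k (MvPolynomial (Fin 3) k))).comp (aeval v) := by
          ext1 j
          simp [Algebra.ofId_apply]
        rw [this]
        simp [Algebra.ofId_apply, aeval_eq_eval]
      rw [map_mul, C_pow, map_pow, ← e1, ← aeval_smul_of_isHomogeneous hA]
      simp only [hX]
      rw [aeval_smul_of_isHomogeneous hA, e2, h0, C_0, map_zero, mul_zero]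
    obtain ⟨h, hh⟩ := (Ideal.mem_span_range_iff_exists_fun).1 (Ideal.Quotient.eq_zero_iff_mem.1 hq)
    exact ⟨h, hh.symm⟩
  have hGv : eval v G = 0 := P.2
  obtain ⟨g, hg⟩ := hspan 3 G hG.homogeneous hGv
  obtain ⟨a, b, hga, hai, hbi, hab⟩ : ∃ a b, eval v (g a) ≠ 0 ∧ a ≠ i ∧ b ≠ i ∧ a ≠ b := by
    obtain ⟨m, hm⟩ := hG.smooth v (P : Plane k).rep_nonzero hGv
    -- All `l j` vanish at `v`, so differentiating `hg` there leaves only the terms with `l j`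
    -- differentiated.
    have hne : ∑ j, eval v (g j) * eval v (pderiv m (l j)) ≠ 0 := by
      have := congrArg (fun A => eval v (pderiv m A)) hg
      simp only [pderiv_C, zero_mul, map_sum, pderiv_mul, map_add, map_mul, hlv, mul_zero, zero_add,
        eval_C] at this
      rw [← this]
      exact mul_ne_zero (pow_ne_zero _ hi) hm
    obtain ⟨a, _, ha⟩ := Finset.exists_ne_zero_of_sum_ne_zero hne
    have hai : a ≠ i := by
      rintro rfl
      simp [hl] at ha
    obtain ⟨b, hb⟩ : ∃ b : Fin 3, b ≠ i ∧ a ≠ b := by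
      revert hai
      clear * -
      revert a i
      decide
    exact ⟨a, b, left_ne_zero_of_mul ha, hai, hb.1, hb.2⟩
  have hsum : ∀ h : Fin 3 → MvPolynomial (Fin 3) k, ∑ j, h j * l j = h a * l a + h b * l b := by
    intro h
    have huniv : (Finset.univ : Finset (Fin 3)) = {i, a, b} := by
      clear * - hai hbi hab
      revert a b i
      decide
    have hli : l i = 0 := by simp [hl]
    rw [huniv, Finset.sum_insert (by simp [hai.symm, hbi.symm]), Finset.sum_pair hab, hli,
      mul_zero, zero_add]
  have hlhom : (l b).IsHomogeneous 1 := (isHomogeneous_C_mul_X _ _).sub (isHomogeneous_C_mul_X _ _)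
  refine ⟨l b, hlhom, hlv b, ?_, ?_⟩
  · refine not_dvd_of_degree_lt hG.homogeneous hlhom (fun h => hi ?_) (by norm_num)
    simpa [hl, hbi.symm] using congrArg (eval (Pi.single b 1)) h
  · intro f hf
    refine Submodule.span_induction ?_ ?_ ?_ ?_ hf
    · rintro A ⟨⟨n, hA⟩, h0⟩
      obtain ⟨h, hh⟩ := hspan n A hA h0
      refine ⟨g a * C (v i ^ n), h b * g a - h a * g b, ?_, h a * C (v i ^ 3), ?_⟩
      · simpa [hi] using hga
      · rw [hsum] at hh hg
        linear_combination g a * hh - h a * hg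
    · exact ⟨1, 0, by simp, by simp⟩
    · rintro A B - - ⟨U, V, hU, hA⟩ ⟨U', V', hU', hB⟩
      refine ⟨U * U', U' * V + U * V', by simp [hU, hU'], ?_⟩
      convert dvd_add (hA.mul_left U') (hB.mul_left U) using 1
      ring
    · rintro W A - ⟨U, V, hU, hA⟩
      refine ⟨U, W * V, hU, ?_⟩
      convert hA.mul_left W using 1
      simp only [smul_eq_mul]
      ring

lemma IsUniformizer.generates_pow {P : Points G} {t : MvPolynomial (Fin 3) k}
    (ht : IsUniformizer P t) (n : ℕ) : ∀ f ∈ pointIdeal (P : Plane k) ^ n,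
      ∃ U V : MvPolynomial (Fin 3) k, eval P.vec U ≠ 0 ∧ G ∣ U * f - V * t ^ n := by
  induction n with
  | zero => exact fun f _ => ⟨1, f, by simp, by simp⟩
  | succ n ih =>
    intro f hf
    rw [pow_succ] at hf
    refine Submodule.mul_induction_on hf ?_ ?_
    · intro A hA B hB
      obtain ⟨U, V, hU, hA⟩ := ih A hA
      obtain ⟨U', V', hU', hB⟩ := ht.generates B hB
      refine ⟨U * U', V * V', by simp [hU, hU'], ?_⟩
      convert dvd_add (hA.mul_left (U' * B)) (hB.mul_left (V * t ^ n)) using 1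
      ring
    · rintro A B ⟨U, V, hU, hA⟩ ⟨U', V', hU', hB⟩
      refine ⟨U * U', U' * V + U * V', by simp [hU, hU'], ?_⟩
      convert dvd_add (hA.mul_left U') (hB.mul_left U) using 1
      ring

/-- In the local ring at `P`, the form `A` is a unit times the `n`-th power of `t`. -/
def HasOrder (P : Points G) (t A : MvPolynomial (Fin 3) k) (n : ℕ) : Prop :=
  ∃ U V : MvPolynomial (Fin 3) k, eval P.vec U ≠ 0 ∧ eval P.vec V ≠ 0 ∧ G ∣ U * A - V * t ^ n

lemma IsUniformizer.not_dvd_pow {P : Points G} {t : MvPolynomial (Fin 3) k} (hp : Prime G)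
    (ht : IsUniformizer P t) (n : ℕ) : ¬ G ∣ t ^ n := fun h => ht.not_dvd (hp.dvd_of_dvd_pow h)

lemma IsUniformizer.vanishesToOrder_iff {P : Points G} {t A : MvPolynomial (Fin 3) k} {n : ℕ}
    (hp : Prime G) (ht : IsUniformizer P t) (h : HasOrder P t A n) (m : ℕ) :
    VanishesToOrder G A P m ↔ m ≤ n := by
  obtain ⟨U, V, hU, hV, hA⟩ := h
  constructor
  · rintro ⟨U', hU', hm⟩
    by_contra! hlt
    obtain ⟨f, hf, g, hg, hfg⟩ := Submodule.mem_sup.1 hm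
    rw [Ideal.mem_span_singleton] at hg
    obtain ⟨U₁, V₁, hU₁, h₁⟩ := ht.generates_pow m f hf
    obtain ⟨d, rfl⟩ : ∃ d, m = n + 1 + d := ⟨m - (n + 1), by omega⟩
    -- After cancelling `tⁿ`, the bracket has to vanish at `P`; but it is a product of three
    -- nonvanishing factors minus a multiple of `t`.
    have hd : G ∣ t ^ n * (U₁ * U' * V - U * V₁ * t ^ d * t) := by
      have := dvd_sub (dvd_add (h₁.mul_left U) (hg.mul_left (U * U₁))) (hA.mul_left (U₁ * U'))
      convert this using 1
      linear_combination (-U * U₁) * hfg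
    have := eval_vec_eq_of_dvd ((hp.dvd_or_dvd hd).resolve_left (ht.not_dvd_pow hp n)) P
    simp [ht.vanishes] at this
    tauto
  · intro hmn
    refine ⟨U, hU, ?_⟩
    obtain ⟨W, hW⟩ := hA
    rw [sub_eq_iff_eq_add'] at hW
    rw [hW]
    refine Submodule.add_mem_sup (Ideal.mul_mem_left _ _ (Ideal.pow_le_pow_right hmn
      (Ideal.pow_mem_pow (mem_pointIdeal ht.homogeneous ht.vanishes) n)))
      (Ideal.mem_span_singleton.2 (dvd_mul_right _ _))

lemma IsUniformizer.ord_eq {P : Points G} {t A : MvPolynomial (Fin 3) k} {n : ℕ}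
    (hp : Prime G) (ht : IsUniformizer P t) (h : HasOrder P t A n) : ord G A P = n := by
  have : {m | VanishesToOrder G A P m} = Set.Iic n :=
    Set.ext fun m => ht.vanishesToOrder_iff hp h m
  rw [ord, this, csSup_Iic]

/-- A form which does not vanish on the curve vanishes to bounded order at each point. -/
lemma exists_bound_of_not_dvd (hp : Prime G) {P : Points G} {t A : MvPolynomial (Fin 3) k}
    (ht : eval P.vec t = 0) (hA : ¬ G ∣ A) : ∃ N : ℕ, ∀ U V : MvPolynomial (Fin 3) k,
      eval P.vec U ≠ 0 → ¬ G ∣ U * A - V * t ^ N := by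
  have : (Ideal.span {G}).IsPrime := (Ideal.span_singleton_prime hp.ne_zero).2 hp
  set q := Ideal.Quotient.mk (Ideal.span {G}) with hq
  have hq0 : ∀ f, q f = 0 ↔ G ∣ f := fun f => by
    rw [hq, Ideal.Quotient.eq_zero_iff_mem, Ideal.mem_span_singleton]
  -- The elements of `S` are the polynomials not vanishing at the chosen representative of `P`, so
  -- `R` is the local ring at that vector of the affine cone over the curve.
  let S : Submonoid (MvPolynomial (Fin 3) k) :=
    (nonZeroDivisors k).comap (eval P.vec)
  have hS : ∀ f, f ∈ S ↔ eval P.vec f ≠ 0 := fun f => by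
    simp [S]
  have hSle : S.map q ≤ nonZeroDivisors _ := by
    rintro _ ⟨f, hf, rfl⟩
    rw [mem_nonZeroDivisors_iff_ne_zero, Ne, hq0]
    intro h
    refine (hS f).1 hf ?_
    simpa using eval_vec_eq_of_dvd (B := 0) (by simpa using h) P
  let R := Localization (S.map q)
  have : IsDomain R := IsLocalization.isDomain_localization hSle
  have : IsNoetherianRing R := IsLocalization.isNoetherianRing (S.map q) R inferInstance
  let φ : MvPolynomial (Fin 3) k →+* R := (algebraMap _ R).comp q
  have hφ : ∀ f, φ f = 0 ↔ G ∣ f := fun f => by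
    rw [← hq0]
    exact IsLocalization.to_map_eq_zero_iff R hSle
  have hφu : ∀ f, eval P.vec f ≠ 0 → IsUnit (φ f) := fun f hf =>
    IsLocalization.map_units R (⟨q f, f, (hS f).2 hf, rfl⟩ : S.map q)
  have htop : Ideal.span {φ t} ≠ ⊤ := by
    rw [Ne, Ideal.span_singleton_eq_top]
    rintro hu
    obtain ⟨r, hr⟩ := hu.exists_right_inv
    obtain ⟨⟨x, ⟨_, s, hs, rfl⟩⟩, hx⟩ := IsLocalization.surj (S.map q) r
    obtain ⟨y, rfl⟩ := Ideal.Quotient.mk_surjective x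
    have : φ (s - t * y) = 0 := by
      have hx : r * φ s = φ y := hx
      rw [map_sub, map_mul, ← hx]
      linear_combination (-φ s) * hr
    have := eval_vec_eq_of_dvd ((hφ _).1 this) P
    rw [map_mul, ht, zero_mul] at this
    exact (hS s).1 hs this
  -- Krull's intersection theorem: a nonzero element is not divisible by all powers of the nonunit
  -- `t`.
  have hbot := Ideal.iInf_pow_eq_bot_of_isDomain _ htop
  have hA' : φ A ∉ ⨅ i : ℕ, Ideal.span {φ t} ^ i := by
    rw [hbot, Ideal.mem_bot, hφ]
    exact hA
  rw [Ideal.mem_iInf] at hA'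
  push Not at hA'
  obtain ⟨N, hN⟩ := hA'
  refine ⟨N, fun U V hU h => hN ?_⟩
  have h := (hφ _).2 h
  rw [map_sub, map_mul, map_mul, map_pow, sub_eq_zero] at h
  rw [Ideal.span_singleton_pow, Ideal.mem_span_singleton]
  exact (hφu U hU).dvd_mul_left.1 ⟨φ V, by rw [h, mul_comm]⟩

/-- If no order existed, the cofactor of `tⁿ` would vanish at `P` at every stage and another `t`
could be split off, against the bound of `exists_bound_of_not_dvd`. -/
lemma IsUniformizer.exists_hasOrder (hG : IsSmoothCubic G) (hp : Prime G) {P : Points G}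
    {t A : MvPolynomial (Fin 3) k} (ht : IsUniformizer P t) {d : ℕ} (hA : A.IsHomogeneous d)
    (hA0 : ¬ G ∣ A) : ∃ n, HasOrder P t A n := by
  obtain ⟨N, hN⟩ := exists_bound_of_not_dvd hp ht.vanishes hA0
  by_contra! hno
  have : ∀ n, ∃ U V : MvPolynomial (Fin 3) k, eval P.vec U ≠ 0 ∧ G ∣ U * A - V * t ^ n := by
    intro n
    induction n with
    | zero => exact ⟨1, A, by simp, by simp⟩
    | succ n ih =>
      obtain ⟨U, V, hU, h⟩ := ih
      -- Membership in `pointIdeal` is obtained from vanishing at `P` only for forms, so the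
      -- relation is first made homogeneous.
      obtain ⟨e, U, V, -, hV, hU, h⟩ := exists_homogeneous_relation hG.homogeneous hA
        (ht.homogeneous.pow n) hU h
      have hV0 : eval P.vec V = 0 := by
        by_contra hV0
        exact hno n ⟨U, V, hU, hV0, h⟩
      obtain ⟨U', V', hU', h'⟩ := ht.generates V (mem_pointIdeal hV hV0)
      refine ⟨U' * U, V', by simp [hU, hU'], ?_⟩
      convert dvd_add (h.mul_left U') (h'.mul_left (t ^ n)) using 1
      ring
  obtain ⟨U, V, hU, h⟩ := this N
  exact hN U V hU h

/-! ### Orders of vanishing of forms -/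

/-- A form which does not vanish identically on the curve `G = 0`. -/
def NonzeroForm (G A : MvPolynomial (Fin 3) k) : Prop := (∃ d, A.IsHomogeneous d) ∧ ¬ G ∣ A

lemma NonzeroForm.mul (hp : Prime G) {A B : MvPolynomial (Fin 3) k} (hA : NonzeroForm G A)
    (hB : NonzeroForm G B) : NonzeroForm G (A * B) := by
  obtain ⟨⟨d, hd⟩, hA⟩ := hA
  obtain ⟨⟨e, he⟩, hB⟩ := hB
  exact ⟨⟨d + e, hd.mul he⟩, fun h => (hp.dvd_or_dvd h).elim hA hB⟩

lemma NonzeroForm.hasOrder (hG : IsSmoothCubic G) (hp : Prime G) {A : MvPolynomial (Fin 3) k}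
    (hA : NonzeroForm G A) {P : Points G} {t : MvPolynomial (Fin 3) k} (ht : IsUniformizer P t) :
    HasOrder P t A (ord G A P) := by
  obtain ⟨⟨d, hd⟩, hA⟩ := hA
  obtain ⟨n, hn⟩ := ht.exists_hasOrder hG hp hd hA
  rwa [ht.ord_eq hp hn]

lemma NonzeroForm.vanishesToOrder_iff (hG : IsSmoothCubic G) (hp : Prime G)
    {A : MvPolynomial (Fin 3) k} (hA : NonzeroForm G A) (P : Points G) (n : ℕ) :
    VanishesToOrder G A P n ↔ n ≤ ord G A P := by
  obtain ⟨t, ht⟩ := exists_isUniformizer hG P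
  exact ht.vanishesToOrder_iff hp (hA.hasOrder hG hp ht) n

lemma ord_mul (hG : IsSmoothCubic G) (hp : Prime G) {A B : MvPolynomial (Fin 3) k}
    (hA : NonzeroForm G A) (hB : NonzeroForm G B) (P : Points G) :
    ord G (A * B) P = ord G A P + ord G B P := by
  obtain ⟨t, ht⟩ := exists_isUniformizer hG P
  obtain ⟨U, V, hU, hV, h⟩ := hA.hasOrder hG hp ht
  obtain ⟨U', V', hU', hV', h'⟩ := hB.hasOrder hG hp ht
  refine ht.ord_eq hp ⟨U * U', V * V', by simp [hU, hU'], by simp [hV, hV'], ?_⟩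
  convert dvd_add (h.mul_left (U' * B)) (h'.mul_left (V * t ^ ord G A P)) using 1
  ring

lemma ord_eq_zero (hG : IsSmoothCubic G) (hp : Prime G) {A : MvPolynomial (Fin 3) k} {P : Points G}
    (h : eval P.vec A ≠ 0) : ord G A P = 0 := by
  obtain ⟨t, ht⟩ := exists_isUniformizer hG P
  exact ht.ord_eq hp ⟨1, A, by simp, h, by simp⟩

lemma ord_pos (hG : IsSmoothCubic G) (hp : Prime G) {A : MvPolynomial (Fin 3) k}
    (hA : NonzeroForm G A) {P : Points G} (h : eval P.vec A = 0) : 1 ≤ ord G A P := by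
  obtain ⟨t, ht⟩ := exists_isUniformizer hG P
  obtain ⟨U, V, hU, hV, hd⟩ := hA.hasOrder hG hp ht
  by_contra! h0
  rw [Nat.lt_one_iff.1 h0, pow_zero, mul_one] at hd
  have := eval_vec_eq_of_dvd hd P
  rw [map_mul, h, mul_zero] at this
  exact hV this.symm

lemma IsUniformizer.ord_eq_one (hp : Prime G) {P : Points G} {t : MvPolynomial (Fin 3) k}
    (ht : IsUniformizer P t) : ord G t P = 1 :=
  ht.ord_eq hp ⟨1, 1, by simp, by simp, by simp⟩

lemma ord_congr {A B : MvPolynomial (Fin 3) k} (h : G ∣ A - B) (P : Plane k) :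
    ord G A P = ord G B P := by
  have : ∀ n, VanishesToOrder G A P n ↔ VanishesToOrder G B P n := fun n => by
    refine exists_congr fun U => and_congr_right fun _ => ?_
    have : U * A - U * B ∈ pointIdeal P ^ n ⊔ Ideal.span {G} := by
      rw [← mul_sub]
      exact Ideal.mul_mem_left _ _ (Ideal.mem_sup_right (Ideal.mem_span_singleton.2 h))
    exact ⟨fun h => by simpa using sub_mem h this, fun h => by simpa using add_mem this h⟩
  simp only [ord, this]

lemma VanishesToOrder.add {A B : MvPolynomial (Fin 3) k} {P : Plane k} {n : ℕ}
    (hA : VanishesToOrder G A P n) (hB : VanishesToOrder G B P n) :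
    VanishesToOrder G (A + B) P n := by
  obtain ⟨U, hU, hA⟩ := hA
  obtain ⟨V, hV, hB⟩ := hB
  refine ⟨U * V, by simp [hU, hV], ?_⟩
  convert add_mem (Ideal.mul_mem_left _ V hA) (Ideal.mul_mem_left _ U hB) using 1
  ring

lemma VanishesToOrder.mul_left {A : MvPolynomial (Fin 3) k} {P : Plane k} {n : ℕ}
    (hA : VanishesToOrder G A P n) (W : MvPolynomial (Fin 3) k) :
    VanishesToOrder G (W * A) P n := by
  obtain ⟨U, hU, hA⟩ := hA
  refine ⟨U, hU, ?_⟩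
  convert Ideal.mul_mem_left _ W hA using 1
  ring

/-! ### Divisors of linear forms -/

/-- The linear forms `l` and `m` span the linear forms vanishing at `P`. -/
structure SpansAt (P : Points G) (l m : MvPolynomial (Fin 3) k) : Prop where
  left : eval P.vec l = 0
  right : eval P.vec m = 0
  span : ∀ t : MvPolynomial (Fin 3) k, t.IsHomogeneous 1 → eval P.vec t = 0 →
    ∃ α β : k, t = C α * l + C β * m

lemma Points.eq_of_forall_linear {P Q : Points G}
    (h : ∀ t : MvPolynomial (Fin 3) k, t.IsHomogeneous 1 → eval P.vec t = 0 → eval Q.vec t = 0) :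
    P = Q := by
  have key : ∀ a b, P.vec a * Q.vec b = P.vec b * Q.vec a := fun a b => by
    have := h (C (P.vec a) * X b - C (P.vec b) * X a)
      ((isHomogeneous_C_mul_X _ _).sub (isHomogeneous_C_mul_X _ _)) (by simp [mul_comm])
    simpa [sub_eq_zero] using this
  refine Subtype.ext ?_
  rw [← (P : Plane k).mk_rep, ← (Q : Plane k).mk_rep,
    Projectivization.mk_eq_mk_iff_crossProduct_eq_zero]
  ext i
  fin_cases i <;> simp [cross_apply, key]

lemma SpansAt.eq_iff {P Q : Points G} {l m : MvPolynomial (Fin 3) k} (h : SpansAt P l m)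
    (hl : eval Q.vec l = 0) : Q = P ↔ eval Q.vec m = 0 := by
  refine ⟨fun hQ => hQ ▸ h.right, fun hm => (Points.eq_of_forall_linear fun t ht h0 => ?_).symm⟩
  obtain ⟨α, β, rfl⟩ := h.span t ht h0
  simp [hl, hm]

/-- Some uniformizer at `P` is a combination of `l` and `m`, so they cannot both vanish to order
two. -/
lemma SpansAt.ord_le_one (hG : IsSmoothCubic G) (hp : Prime G) {P : Points G}
    {l m : MvPolynomial (Fin 3) k} (h : SpansAt P l m) (hl : NonzeroForm G l)
    (hm : NonzeroForm G m) : ord G l P ≤ 1 ∨ ord G m P ≤ 1 := by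
  by_contra! hlt
  obtain ⟨t, ht⟩ := exists_isUniformizer hG P
  obtain ⟨α, β, hαβ⟩ := h.span t ht.homogeneous ht.vanishes
  have h2 : VanishesToOrder G t P 2 := by
    rw [hαβ]
    exact (((hl.vanishesToOrder_iff hG hp P 2).2 hlt.1).mul_left _).add
      (((hm.vanishesToOrder_iff hG hp P 2).2 hlt.2).mul_left _)
  rw [NonzeroForm.vanishesToOrder_iff hG hp ⟨⟨1, ht.homogeneous⟩, ht.not_dvd⟩,
    ht.ord_eq_one hp] at h2
  omega

/-- `D` is the divisor cut out by the linear form `l`. -/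
structure IsLineDivisor (l : MvPolynomial (Fin 3) k) (D : Divisor G) : Prop where
  homogeneous : l.IsHomogeneous 1
  not_dvd : ¬ G ∣ l
  eq_ord : ∀ P : Points G, D P = ord G l P

/-- If `G` restricted to the line `l = 0` factors as `m₁ m₂ m₃`, then the line meets the curve
in the three points `l = mᵢ = 0`. -/
theorem ord_line (hG : IsSmoothCubic G) (hp : Prime G) {l q m₁ m₂ m₃ : MvPolynomial (Fin 3) k}
    (hl : l.IsHomogeneous 1) (hq : q.IsHomogeneous 2) (h₁ : m₁.IsHomogeneous 1)
    (h₂ : m₂.IsHomogeneous 1) (h₃ : m₃.IsHomogeneous 1) (hGeq : G = l * q - m₁ * m₂ * m₃)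
    {P₁ P₂ P₃ : Points G} (hP₁ : SpansAt P₁ l m₁) (hP₂ : SpansAt P₂ l m₂)
    (hP₃ : SpansAt P₃ l m₃) :
    IsLineDivisor l (Finsupp.single P₁ 1 + Finsupp.single P₂ 1 + Finsupp.single P₃ 1) := by
  classical
  have hdvd : ∀ {n : ℕ} {A : MvPolynomial (Fin 3) k}, A.IsHomogeneous n → n < 3 → A ≠ 0 →
      NonzeroForm G A :=
    fun hA hn h0 => ⟨⟨_, hA⟩, not_dvd_of_degree_lt hG.homogeneous hA h0 hn⟩
  -- Otherwise the prime cubic `G` would divide a product of linear forms.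
  have hlq : l * q ≠ 0 := fun h => by
    rw [h, zero_sub] at hGeq
    have h0 : m₁ * m₂ * m₃ ≠ 0 := fun h => hp.ne_zero (by rw [hGeq, h, neg_zero])
    have hd : G ∣ m₁ * m₂ * m₃ := by
      rw [← dvd_neg, ← hGeq]
    have h12 := left_ne_zero_of_mul h0
    rcases hp.dvd_or_dvd hd with hd | hd
    · rcases hp.dvd_or_dvd hd with hd | hd
      · exact (hdvd h₁ (by norm_num) (left_ne_zero_of_mul h12)).2 hd
      · exact (hdvd h₂ (by norm_num) (right_ne_zero_of_mul h12)).2 hd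
    · exact (hdvd h₃ (by norm_num) (right_ne_zero_of_mul h0)).2 hd
  have nl := hdvd hl (by norm_num) (left_ne_zero_of_mul hlq)
  have nq := hdvd hq (by norm_num) (right_ne_zero_of_mul hlq)
  have hm : m₁ * m₂ * m₃ ≠ 0 := fun h => by
    rw [h, sub_zero] at hGeq
    rcases hp.dvd_or_dvd hGeq.dvd with hd | hd
    · exact nl.2 hd
    · exact nq.2 hd
  have n₁ := hdvd h₁ (by norm_num) (left_ne_zero_of_mul (left_ne_zero_of_mul hm))
  have n₂ := hdvd h₂ (by norm_num) (right_ne_zero_of_mul (left_ne_zero_of_mul hm))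
  have n₃ := hdvd h₃ (by norm_num) (right_ne_zero_of_mul hm)
  refine ⟨hl, nl.2, fun P => ?_⟩
  simp only [Finsupp.add_apply, Finsupp.single_apply, eq_comm (b := P)]
  by_cases hlP : eval P.vec l = 0
  · have hsum : ord G l P + ord G q P = ord G m₁ P + ord G m₂ P + ord G m₃ P := by
      rw [← ord_mul hG hp nl nq, ← ord_mul hG hp n₁ n₂, ← ord_mul hG hp (n₁.mul hp n₂) n₃]
      exact ord_congr hGeq.dvd P
    have hpos := ord_pos hG hp nl hlP
    have hcase : ∀ {m : MvPolynomial (Fin 3) k} {R : Points G}, NonzeroForm G m → SpansAt R l m →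
        (P = R ∧ (if P = R then (1 : ℤ) else 0) = 1 ∧ 1 ≤ ord G m P ∧
          (ord G l P ≤ 1 ∨ ord G m P ≤ 1)) ∨
        (P ≠ R ∧ (if P = R then (1 : ℤ) else 0) = 0 ∧ ord G m P = 0) := by
      intro m R hm hR
      by_cases hPR : P = R
      · subst hPR
        exact Or.inl ⟨rfl, if_pos rfl, ord_pos hG hp hm hR.right, hR.ord_le_one hG hp nl hm⟩
      · exact Or.inr ⟨hPR, if_neg hPR, ord_eq_zero hG hp fun h => hPR ((hR.eq_iff hlP).2 h)⟩
    -- If `l`, `q` and two of the `mᵢ` vanish at `P`, every partial derivative of `G` vanishes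
    -- there.
    have hsing : eval P.vec q = 0 → ¬ (P = P₁ ∧ P = P₂) ∧ ¬ (P = P₁ ∧ P = P₃) ∧
        ¬ (P = P₂ ∧ P = P₃) := by
      intro hqP
      rw [hP₁.eq_iff hlP, hP₂.eq_iff hlP, hP₃.eq_iff hlP]
      obtain ⟨i, hi⟩ := hG.smooth P.vec (P : Plane k).rep_nonzero P.2
      have : pderiv i G = pderiv i l * q + l * pderiv i q -
          ((pderiv i m₁ * m₂ + m₁ * pderiv i m₂) * m₃ + m₁ * m₂ * pderiv i m₃) := by
        rw [← pderiv_mul, ← pderiv_mul, ← pderiv_mul, ← map_sub, ← hGeq]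
      rw [this] at hi
      simp only [map_sub, map_add, map_mul, hlP, hqP] at hi
      refine ⟨?_, ?_, ?_⟩ <;> rintro ⟨h, h'⟩ <;> simp [h, h'] at hi
    have hq' : ord G q P = 0 ∨ 1 ≤ ord G q P ∧ ¬ (P = P₁ ∧ P = P₂) ∧ ¬ (P = P₁ ∧ P = P₃) ∧
        ¬ (P = P₂ ∧ P = P₃) := by
      by_cases hqP : eval P.vec q = 0
      · exact Or.inr ⟨ord_pos hG hp nq hqP, hsing hqP⟩
      · exact Or.inl (ord_eq_zero hG hp hqP)
    -- Let `n` be the number of indices with `P = Pᵢ`. If `q(P) ≠ 0`, then `ord l` is the sum of `n`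
    -- positive orders; it is positive, so `n > 0`, and the bounds `b₁, b₂, b₃` force each order to
    -- be one. If `q(P) = 0`, then `n = 1` and `ord mᵢ = ord l + ord q ≥ 2`, so `ord l = 1`.
    rcases hcase n₁ hP₁ with ⟨e₁, i₁, a₁, b₁⟩ | ⟨e₁, i₁, a₁⟩ <;>
    rcases hcase n₂ hP₂ with ⟨e₂, i₂, a₂, b₂⟩ | ⟨e₂, i₂, a₂⟩ <;>
    rcases hcase n₃ hP₃ with ⟨e₃, i₃, a₃, b₃⟩ | ⟨e₃, i₃, a₃⟩ <;>
    rw [i₁, i₂, i₃] <;>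
    clear i₁ i₂ i₃ <;>
    rcases hq' with hq' | ⟨hq', h12, h13, h23⟩ <;>
    first | omega | exact absurd ⟨‹P = P₁›, ‹P = P₂›⟩ h12 | exact absurd ⟨‹P = P₁›, ‹P = P₃›⟩ h13 |
      exact absurd ⟨‹P = P₂›, ‹P = P₃›⟩ h23
  · rw [ord_eq_zero hG hp hlP, if_neg, if_neg, if_neg]
    · simp
    · rintro rfl; exact hlP hP₃.left
    · rintro rfl; exact hlP hP₂.left
    · rintro rfl; exact hlP hP₁.left

/-! ### The class group -/

/-- Orders are additive on products, so divisors of functions are already closed under the group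
operations. -/
lemma isDivisorOfFunction_of_mem (hG : IsSmoothCubic G) (hp : Prime G) {D : Divisor G}
    (hD : D ∈ principalDivisors G) : IsDivisorOfFunction G D := by
  refine AddSubgroup.closure_induction (fun D hD => hD) ?_ ?_ ?_ hD
  · have h1 : ¬ G ∣ 1 := fun h => hp.not_isUnit (isUnit_of_dvd_one h)
    exact ⟨0, 1, 1, isHomogeneous_one _ _, isHomogeneous_one _ _, h1, h1, by simp⟩
  · rintro D D' - - ⟨d, A, B, hA, hB, nA, nB, h⟩ ⟨d', A', B', hA', hB', nA', nB', h'⟩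
    refine ⟨d + d', A * A', B * B', hA.mul hA', hB.mul hB',
      fun hd => (hp.dvd_or_dvd hd).elim nA nA', fun hd => (hp.dvd_or_dvd hd).elim nB nB',
      fun P => ?_⟩
    rw [ord_mul hG hp ⟨⟨d, hA⟩, nA⟩ ⟨⟨d', hA'⟩, nA'⟩, ord_mul hG hp ⟨⟨d, hB⟩, nB⟩ ⟨⟨d', hB'⟩, nB'⟩,
      Finsupp.add_apply, h, h']
    push_cast
    ring
  · rintro D - ⟨d, A, B, hA, hB, nA, nB, h⟩
    exact ⟨d, B, A, hB, hA, nB, nA, fun P => by rw [Finsupp.neg_apply, h]; ring⟩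

/-- Linearly equivalent divisors. -/
def divisorClass (D : Divisor G) : Pic G := QuotientAddGroup.mk D

lemma IsLineDivisor.divisorClass_eq {l l' : MvPolynomial (Fin 3) k} {D D' : Divisor G}
    (h : IsLineDivisor l D) (h' : IsLineDivisor l' D') : divisorClass D = divisorClass D' := by
  refine (QuotientAddGroup.eq_iff_sub_mem).2 (AddSubgroup.subset_closure ?_)
  exact ⟨1, l, l', h.homogeneous, h'.homogeneous, h.not_dvd, h'.not_dvd,
    fun P => by rw [Finsupp.sub_apply, h.eq_ord, h'.eq_ord]⟩

/-! ### Coordinates in which the cubic has a Weierstrass equation -/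

/-- In the coordinates given by the rows of `M`, the curve `G = 0` has a Weierstrass equation. -/
structure IsWeierstrass (G : MvPolynomial (Fin 3) k) (M : Matrix (Fin 3) (Fin 3) k) (a b c : k) :
    Prop where
  det : IsUnit M.det
  eq : G = subst M (weierstrass a b c)
  smooth : IsSmoothCubic G

variable {M : Matrix (Fin 3) (Fin 3) k} {a b c : k}

lemma IsWeierstrass.equation (hW : IsWeierstrass G M a b c) :
    G = linForm (M 1) ^ 2 * linForm (M 2) - (linForm (M 0) ^ 3 +
      C a * (linForm (M 0) ^ 2 * linForm (M 2)) + C b * (linForm (M 0) * linForm (M 2) ^ 2) +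
      C c * linForm (M 2) ^ 3) := by
  rw [hW.eq]
  simp only [weierstrass, map_sub, map_add, map_mul, map_pow, subst_X, subst_C]

lemma IsWeierstrass.prime (hW : IsWeierstrass G M a b c) : Prime G := by
  rw [hW.eq]
  exact (MulEquiv.prime_iff (substEquiv M hW.det).toMulEquiv).2 (prime_weierstrass a b c)

lemma IsWeierstrass.linear (hW : IsWeierstrass G M a b c) {t : MvPolynomial (Fin 3) k}
    (ht : t.IsHomogeneous 1) : ∃ α β γ : k,
      t = C α * linForm (M 0) + C β * linForm (M 1) + C γ * linForm (M 2) := by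
  obtain ⟨t, rfl⟩ := (substEquiv M hW.det).surjective t
  have ht' : t.IsHomogeneous 1 := by
    have := subst_isHomogeneous M⁻¹ ht
    rwa [substEquiv_apply, subst_subst, Matrix.mul_nonsing_inv M hW.det, subst_one] at this
  rw [substEquiv_apply]
  refine homogeneous_induction (p := fun t => ∃ α β γ : k,
      subst M t = C α * linForm (M 0) + C β * linForm (M 1) + C γ * linForm (M 2)) ?_ ?_ ?_ ht'
  · rintro A B ⟨α, β, γ, hA⟩ ⟨α', β', γ', hB⟩
    refine ⟨α + α', β + β', γ + γ', ?_⟩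
    simp only [map_add, hA, hB]
    ring
  · exact ⟨0, 0, 0, by simp⟩
  · intro r i j l h
    obtain ⟨rfl, rfl, rfl⟩ | ⟨rfl, rfl, rfl⟩ | ⟨rfl, rfl, rfl⟩ :
      (i = 1 ∧ j = 0 ∧ l = 0) ∨ (i = 0 ∧ j = 1 ∧ l = 0) ∨ (i = 0 ∧ j = 0 ∧ l = 1) := by omega
    · exact ⟨r, 0, 0, by simp⟩
    · exact ⟨0, r, 0, by simp⟩
    · exact ⟨0, 0, r, by simp⟩

lemma IsWeierstrass.exists_coord_ne_zero (hW : IsWeierstrass G M a b c) (P : Points G) :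
    ∃ i, eval P.vec (linForm (M i)) ≠ 0 := by
  obtain ⟨i, hi⟩ := Function.ne_iff.1 (mulVec_ne_zero hW.det (P : Plane k).rep_nonzero)
  exact ⟨i, by simpa [Matrix.mulVec] using hi⟩

lemma IsWeierstrass.eval_equation (hW : IsWeierstrass G M a b c) (P : Points G) :
    eval P.vec (linForm (M 1)) ^ 2 * eval P.vec (linForm (M 2)) =
      eval P.vec (linForm (M 0)) ^ 3 + a * (eval P.vec (linForm (M 0)) ^ 2 *
        eval P.vec (linForm (M 2))) + b * (eval P.vec (linForm (M 0)) *
        eval P.vec (linForm (M 2)) ^ 2) + c * eval P.vec (linForm (M 2)) ^ 3 := by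
  have h := (congrArg (eval P.vec) hW.equation).symm.trans P.2
  simpa [sub_eq_zero, -eval_linForm] using h

/-- The point at infinity of a Weierstrass cubic. -/
structure IsInfinity (M : Matrix (Fin 3) (Fin 3) k) (P : Points G) : Prop where
  x_eq : eval P.vec (linForm (M 0)) = 0
  z_eq : eval P.vec (linForm (M 2)) = 0

/-- The point of a Weierstrass cubic with affine coordinates `r` and `s`. -/
structure HasCoords (M : Matrix (Fin 3) (Fin 3) k) (P : Points G) (r s : k) : Prop where
  z_ne : eval P.vec (linForm (M 2)) ≠ 0
  x_eq : eval P.vec (linForm (M 0)) = r * eval P.vec (linForm (M 2))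
  y_eq : eval P.vec (linForm (M 1)) = s * eval P.vec (linForm (M 2))

lemma IsInfinity.y_ne {P : Points G} (hW : IsWeierstrass G M a b c) (h : IsInfinity M P) :
    eval P.vec (linForm (M 1)) ≠ 0 := by
  obtain ⟨i, hi⟩ := hW.exists_coord_ne_zero P
  fin_cases i
  · exact absurd h.x_eq hi
  · exact hi
  · exact absurd h.z_eq hi

lemma IsWeierstrass.isInfinity_of_z_eq_zero (hW : IsWeierstrass G M a b c) {P : Points G}
    (h : eval P.vec (linForm (M 2)) = 0) : IsInfinity M P := by
  refine ⟨?_, h⟩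
  have := hW.eval_equation P
  rw [h] at this
  exact pow_eq_zero_iff (n := 3) (by norm_num) |>.1 (by linear_combination -this)

lemma IsWeierstrass.isInfinity_or_hasCoords (hW : IsWeierstrass G M a b c) (P : Points G) :
    IsInfinity M P ∨ ∃ r s, HasCoords M P r s := by
  by_cases h : eval P.vec (linForm (M 2)) = 0
  · exact Or.inl (hW.isInfinity_of_z_eq_zero h)
  · exact Or.inr ⟨_ / _, _ / _, h, (div_mul_cancel₀ _ h).symm, (div_mul_cancel₀ _ h).symm⟩

lemma HasCoords.equation {P : Points G} {r s : k} (hW : IsWeierstrass G M a b c)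
    (h : HasCoords M P r s) : s ^ 2 = r ^ 3 + a * r ^ 2 + b * r + c := by
  have := hW.eval_equation P
  rw [h.x_eq, h.y_eq] at this
  refine mul_right_cancel₀ (pow_ne_zero 3 h.z_ne) ?_
  linear_combination this

lemma IsWeierstrass.exists_point (hW : IsWeierstrass G M a b c) {w : Fin 3 → k} (hw : w ≠ 0)
    (h : eval w (weierstrass a b c) = 0) :
    ∃ (P : Points G) (μ : k), μ ≠ 0 ∧ ∀ i, eval P.vec (linForm (M i)) = μ * w i := by
  have hdet : IsUnit M⁻¹.det := Matrix.isUnit_nonsing_inv_det_iff.2 hW.det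
  have hne := mulVec_ne_zero hdet hw
  obtain ⟨μ, hμ⟩ := Projectivization.exists_smul_eq_mk_rep k _ hne
  have hMv : M *ᵥ (Projectivization.mk k _ hne).rep = (μ : k) • w := by
    rw [← hμ, Units.smul_def, Matrix.mulVec_smul, Matrix.mulVec_mulVec,
      Matrix.mul_nonsing_inv M hW.det, Matrix.one_mulVec]
  refine ⟨⟨Projectivization.mk k _ hne, ?_⟩, μ, μ.ne_zero, fun i => ?_⟩
  · change eval _ G = 0
    have hhom : (weierstrass a b c).IsHomogeneous 3 := by
      have := subst_isHomogeneous M⁻¹ (hW.eq ▸ hW.smooth.homogeneous)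
      rwa [subst_subst, Matrix.mul_nonsing_inv M hW.det, subst_one] at this
    rw [hW.eq, eval_subst, hMv, eval_smul_of_isHomogeneous hhom, h, mul_zero]
  · rw [eval_linForm]
    exact congrFun hMv i

lemma IsWeierstrass.exists_isInfinity (hW : IsWeierstrass G M a b c) :
    ∃ O : Points G, IsInfinity M O := by
  obtain ⟨O, μ, -, h⟩ := hW.exists_point (w := ![0, 1, 0]) (by simp) (by simp [weierstrass])
  exact ⟨O, by simp [h, -eval_linForm], by simp [h, -eval_linForm]⟩

lemma IsWeierstrass.exists_hasCoords (hW : IsWeierstrass G M a b c) {r s : k}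
    (h : s ^ 2 = r ^ 3 + a * r ^ 2 + b * r + c) : ∃ P : Points G, HasCoords M P r s := by
  obtain ⟨P, μ, hμ, hP⟩ := hW.exists_point (w := ![r, s, 1]) (fun h => by simpa using congrFun h 2)
    (by simp [weierstrass]; linear_combination h)
  exact ⟨P, by simpa [hP, -eval_linForm] using hμ, by simp [hP, mul_comm, -eval_linForm],
    by simp [hP, mul_comm, -eval_linForm]⟩

lemma HasCoords.eq {P Q : Points G} {r s : k} (hW : IsWeierstrass G M a b c)
    (hP : HasCoords M P r s) (hQ : HasCoords M Q r s) : P = Q := by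
  refine Points.eq_of_forall_linear fun t ht h => ?_
  obtain ⟨α, β, γ, rfl⟩ := hW.linear ht
  simp only [map_add, map_mul, eval_C, hP.x_eq, hP.y_eq, hQ.x_eq, hQ.y_eq] at h ⊢
  have : α * r + β * s + γ = 0 := (mul_eq_zero_iff_right hP.z_ne).1 (by linear_combination h)
  linear_combination eval Q.vec (linForm (M 2)) * this

lemma IsInfinity.eq {P Q : Points G} (hW : IsWeierstrass G M a b c)
    (hP : IsInfinity M P) (hQ : IsInfinity M Q) : P = Q := by
  refine Points.eq_of_forall_linear fun t ht h => ?_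
  obtain ⟨α, β, γ, rfl⟩ := hW.linear ht
  have := hP.y_ne hW
  simp only [map_add, map_mul, eval_C, hP.x_eq, hP.z_eq, hQ.x_eq, hQ.z_eq, mul_zero, zero_add,
    add_zero, mul_eq_zero, this, or_false] at h ⊢
  exact Or.inl h

lemma HasCoords.not_isInfinity {P : Points G} {r s : k} (hP : HasCoords M P r s) :
    ¬ IsInfinity M P := fun h => hP.z_ne h.z_eq

lemma IsInfinity.spansAt {O : Points G} (hW : IsWeierstrass G M a b c) (hO : IsInfinity M O)
    (r : k) : SpansAt O (linForm (M 0) - C r * linForm (M 2)) (linForm (M 2)) := by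
  refine ⟨by simp [hO.x_eq, hO.z_eq, -eval_linForm], hO.z_eq, fun t ht h => ?_⟩
  obtain ⟨α, β, γ, rfl⟩ := hW.linear ht
  have := hO.y_ne hW
  simp only [map_add, map_mul, eval_C, hO.x_eq, hO.z_eq, mul_zero, zero_add,
    add_zero, mul_eq_zero, this, or_false] at h
  exact ⟨α, α * r + γ, by simp [h]; ring⟩

lemma SpansAt.symm {P : Points G} {l m : MvPolynomial (Fin 3) k} (h : SpansAt P l m) :
    SpansAt P m l := by
  refine ⟨h.right, h.left, fun t ht h0 => ?_⟩
  obtain ⟨α, β, rfl⟩ := h.span t ht h0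
  exact ⟨β, α, add_comm _ _⟩

lemma HasCoords.spansAt_vertical {P : Points G} {r s : k} (hW : IsWeierstrass G M a b c)
    (hP : HasCoords M P r s) : SpansAt P (linForm (M 0) - C r * linForm (M 2))
      (linForm (M 1) - C s * linForm (M 2)) := by
  refine ⟨by simp [hP.x_eq, -eval_linForm], by simp [hP.y_eq, -eval_linForm], fun t ht h => ?_⟩
  obtain ⟨α, β, γ, rfl⟩ := hW.linear ht
  simp only [map_add, map_mul, eval_C, hP.x_eq, hP.y_eq] at h
  have : α * r + β * s + γ = 0 := (mul_eq_zero_iff_right hP.z_ne).1 (by linear_combination h)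
  obtain rfl : γ = -(α * r + β * s) := by linear_combination this
  exact ⟨α, β, by simp; ring⟩

lemma HasCoords.spansAt {P : Points G} {m e r : k} (hW : IsWeierstrass G M a b c)
    (hP : HasCoords M P r (m * r + e)) :
    SpansAt P (linForm (M 1) - C m * linForm (M 0) - C e * linForm (M 2))
      (linForm (M 0) - C r * linForm (M 2)) := by
  have h := hP.spansAt_vertical hW
  refine ⟨by simp [hP.x_eq, hP.y_eq, -eval_linForm]; ring, h.left, fun t ht h0 => ?_⟩
  obtain ⟨α, β, rfl⟩ := h.span t ht h0
  exact ⟨β, α + β * m, by simp; ring⟩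

lemma isHomogeneous_sub_C_mul {σ : Type*} {l m : MvPolynomial σ k} (hl : l.IsHomogeneous 1)
    (hm : m.IsHomogeneous 1) (r : k) : (l - C r * m).IsHomogeneous 1 := hl.sub (hm.C_mul r)

/-- The line at infinity is the flex tangent. -/
lemma IsInfinity.isLineDivisor {O : Points G} (hW : IsWeierstrass G M a b c)
    (hO : IsInfinity M O) : IsLineDivisor (linForm (M 2))
      (Finsupp.single O 1 + Finsupp.single O 1 + Finsupp.single O 1 : Divisor G) := by
  have hx := linForm_isHomogeneous (M 0)
  have hy := linForm_isHomogeneous (M 1)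
  have hz := linForm_isHomogeneous (M 2)
  have hs := (hO.spansAt hW 0).symm
  rw [C_0, zero_mul, sub_zero] at hs
  refine ord_line hW.smooth hW.prime (q := linForm (M 1) * linForm (M 1) -
    C a * (linForm (M 0) * linForm (M 0)) - C b * (linForm (M 0) * linForm (M 2)) -
    C c * (linForm (M 2) * linForm (M 2))) hz ?_ hx hx hx ?_ hs hs hs
  · exact (((hy.mul hy).sub ((hx.mul hx).C_mul a)).sub ((hx.mul hz).C_mul b)).sub
      ((hz.mul hz).C_mul c)
  · refine hW.equation.trans ?_
    ring

/-- A vertical line meets the cubic in the point at infinity and in two opposite points. -/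
lemma HasCoords.isLineDivisor_vertical {O P Q : Points G} {r s : k}
    (hW : IsWeierstrass G M a b c) (hO : IsInfinity M O) (hP : HasCoords M P r s)
    (hQ : HasCoords M Q r (-s)) : IsLineDivisor (linForm (M 0) - C r * linForm (M 2))
      (Finsupp.single O 1 + Finsupp.single P 1 + Finsupp.single Q 1 : Divisor G) := by
  have hx := linForm_isHomogeneous (M 0)
  have hy := linForm_isHomogeneous (M 1)
  have hz := linForm_isHomogeneous (M 2)
  have heq := hP.equation hW
  -- On `x = r z` the equation becomes `z (y - s z) (y + s z)`; the sign in `m₁` matches the form `l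
  -- q - m₁ m₂ m₃`.
  refine ord_line hW.smooth hW.prime (q := C (-1) * (linForm (M 0) * linForm (M 0)) -
    C (r + a) * (linForm (M 0) * linForm (M 2)) -
    C (r ^ 2 + a * r + b) * (linForm (M 2) * linForm (M 2)))
    (m₁ := C (-1) * linForm (M 2)) (m₂ := linForm (M 1) - C s * linForm (M 2))
    (m₃ := linForm (M 1) - C (-s) * linForm (M 2)) (isHomogeneous_sub_C_mul hx hz _) ?_
    (hz.C_mul _) (isHomogeneous_sub_C_mul hy hz _) (isHomogeneous_sub_C_mul hy hz _) ?_ ?_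
    (hP.spansAt_vertical hW) (hQ.spansAt_vertical hW)
  · exact (((hx.mul hx).C_mul _).sub ((hx.mul hz).C_mul _)).sub ((hz.mul hz).C_mul _)
  · obtain rfl : c = s ^ 2 - (r ^ 3 + a * r ^ 2 + b * r) := by linear_combination -heq
    refine hW.equation.trans ?_
    simp only [map_sub, map_add, map_mul, map_pow, map_neg, map_one]
    ring
  · have h := hO.spansAt hW r
    refine ⟨h.left, by simp [hO.z_eq, -eval_linForm], fun t ht h0 => ?_⟩
    obtain ⟨α, β, rfl⟩ := h.span t ht h0
    exact ⟨α, -β, by simp⟩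

/-- The intersection of the cubic with a line which is not vertical. -/
lemma isLineDivisor_chord {P₁ P₂ P₃ : Points G} {m e r₁ r₂ r₃ : k}
    (hW : IsWeierstrass G M a b c) (h₁ : HasCoords M P₁ r₁ (m * r₁ + e))
    (h₂ : HasCoords M P₂ r₂ (m * r₂ + e)) (h₃ : HasCoords M P₃ r₃ (m * r₃ + e))
    (ha : m ^ 2 - a = r₁ + r₂ + r₃) (hb : b - 2 * m * e = r₁ * r₂ + r₁ * r₃ + r₂ * r₃)
    (hc : e ^ 2 - c = r₁ * r₂ * r₃) :
    IsLineDivisor (linForm (M 1) - C m * linForm (M 0) - C e * linForm (M 2))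
      (Finsupp.single P₁ 1 + Finsupp.single P₂ 1 + Finsupp.single P₃ 1 : Divisor G) := by
  have hx := linForm_isHomogeneous (M 0)
  have hy := linForm_isHomogeneous (M 1)
  have hz := linForm_isHomogeneous (M 2)
  -- The equation is `z (y² - (m x + e z)²) - ∏ (x - rᵢ z)`: the hypotheses `ha`, `hb`, `hc` are
  -- Vieta's relations for the abscissas on the line.
  refine ord_line hW.smooth hW.prime (q := linForm (M 2) * (linForm (M 1) + C m * linForm (M 0) +
    C e * linForm (M 2)))
    (isHomogeneous_sub_C_mul (isHomogeneous_sub_C_mul hy hx _) hz _) ?_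
    (isHomogeneous_sub_C_mul hx hz _) (isHomogeneous_sub_C_mul hx hz _)
    (isHomogeneous_sub_C_mul hx hz _) ?_ (h₁.spansAt hW) (h₂.spansAt hW) (h₃.spansAt hW)
  · exact hz.mul ((hy.add (hx.C_mul _)).add (hz.C_mul _))
  · obtain rfl : a = m ^ 2 - (r₁ + r₂ + r₃) := by linear_combination -ha
    obtain rfl : b = 2 * m * e + (r₁ * r₂ + r₁ * r₃ + r₂ * r₃) := by linear_combination hb
    obtain rfl : c = e ^ 2 - r₁ * r₂ * r₃ := by linear_combination -hc
    refine hW.equation.trans ?_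
    have hC2 : (C 2 : MvPolynomial (Fin 3) k) = 2 := map_ofNat C 2
    simp only [map_sub, map_add, map_mul, map_pow, hC2]
    ring

/-! ### Forms with prescribed orders of vanishing -/

lemma VanishesToOrder.eval_eq_zero {A : MvPolynomial (Fin 3) k} {P : Points G} {n : ℕ}
    (hp : Prime G) (hG : IsSmoothCubic G)
    (h : VanishesToOrder G A P (n + 1)) : eval P.vec A = 0 := by
  by_contra hA
  obtain ⟨t, ht⟩ := exists_isUniformizer hG P
  have := (ht.vanishesToOrder_iff hp (A := A) (n := 0) ⟨1, A, by simp, hA, by simp⟩ _).1 h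
  omega

lemma VanishesToOrder.of_mul_left {A W : MvPolynomial (Fin 3) k} {P : Points G} {n : ℕ}
    (h : VanishesToOrder G (W * A) P n) (hW : eval P.vec W ≠ 0) : VanishesToOrder G A P n := by
  obtain ⟨U, hU, h⟩ := h
  exact ⟨U * W, by simp [hU, hW], by rwa [mul_assoc]⟩

lemma VanishesToOrder.congr {A B : MvPolynomial (Fin 3) k} {P : Plane k} {n : ℕ}
    (hA : VanishesToOrder G A P n) (h : G ∣ A - B) : VanishesToOrder G B P n := by
  obtain ⟨U, hU, hA⟩ := hA
  refine ⟨U, hU, ?_⟩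
  have : U * A - U * B ∈ pointIdeal P ^ n ⊔ Ideal.span {G} := by
    rw [← mul_sub]
    exact Ideal.mul_mem_left _ _ (Ideal.mem_sup_right (Ideal.mem_span_singleton.2 h))
  simpa using sub_mem hA this

lemma IsInfinity.ord_z {O : Points G} (hW : IsWeierstrass G M a b c) (hO : IsInfinity M O) :
    ord G (linForm (M 2)) O = 3 := by
  have := (hO.isLineDivisor hW).eq_ord O
  simp at this
  omega

lemma IsInfinity.ord_x {O : Points G} (hW : IsWeierstrass G M a b c) (hO : IsInfinity M O) :
    NonzeroForm G (linForm (M 0)) ∧ ord G (linForm (M 0)) O ≤ 1 := by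
  have hx : NonzeroForm G (linForm (M 0)) := by
    refine ⟨⟨1, linForm_isHomogeneous _⟩, not_dvd_of_degree_lt hW.smooth.homogeneous
      (linForm_isHomogeneous _) (fun h => ?_) (by norm_num)⟩
    rw [← subst_X, ← substEquiv_apply M hW.det, EmbeddingLike.map_eq_zero_iff] at h
    exact X_ne_zero 0 h
  have hs := hO.spansAt hW 0
  rw [C_0, zero_mul, sub_zero] at hs
  have hz := hO.isLineDivisor hW
  refine ⟨hx, (hs.ord_le_one hW.smooth hW.prime hx ⟨⟨1, hz.homogeneous⟩, hz.not_dvd⟩).resolve_right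
    ?_⟩
  rw [hO.ord_z hW]
  norm_num

/-- Modulo `G` the power `x³` is a multiple of `z`, so only monomials with `x`-exponent at most two
survive modulo `z`. They are kept because their orders at infinity are different. -/
lemma IsWeierstrass.normal_form (hW : IsWeierstrass G M a b c) {n : ℕ}
    {A : MvPolynomial (Fin 3) k} (hA : A.IsHomogeneous n) :
    ∃ (B : MvPolynomial (Fin 3) k) (c₀ c₁ c₂ : k), B.IsHomogeneous (n - 1) ∧
      G ∣ A - (linForm (M 2) * B + C c₀ * linForm (M 1) ^ n +
        C c₁ * linForm (M 1) ^ (n - 1) * linForm (M 0) +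
        C c₂ * linForm (M 1) ^ (n - 2) * (linForm (M 0) * linForm (M 0))) := by
  have hx := linForm_isHomogeneous (M 0)
  have hy := linForm_isHomogeneous (M 1)
  have hz := linForm_isHomogeneous (M 2)
  obtain ⟨A, rfl⟩ := (substEquiv M hW.det).surjective A
  have hA' : A.IsHomogeneous n := by
    have := subst_isHomogeneous M⁻¹ hA
    rwa [substEquiv_apply, subst_subst, Matrix.mul_nonsing_inv M hW.det, subst_one] at this
  rw [substEquiv_apply]
  refine homogeneous_induction (p := fun A => ∃ (B : MvPolynomial (Fin 3) k) (c₀ c₁ c₂ : k),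
    B.IsHomogeneous (n - 1) ∧ G ∣ subst M A - (linForm (M 2) * B + C c₀ * linForm (M 1) ^ n +
        C c₁ * linForm (M 1) ^ (n - 1) * linForm (M 0) +
        C c₂ * linForm (M 1) ^ (n - 2) * (linForm (M 0) * linForm (M 0)))) ?_ ?_ ?_ hA'
  · rintro A A' ⟨B, c₀, c₁, c₂, hB, h⟩ ⟨B', c₀', c₁', c₂', hB', h'⟩
    refine ⟨B + B', c₀ + c₀', c₁ + c₁', c₂ + c₂', hB.add hB', ?_⟩
    convert dvd_add h h' using 1
    simp only [map_add]
    ring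
  · exact ⟨0, 0, 0, 0, isHomogeneous_zero _ _ _, by simp⟩
  · rintro r i j l rfl
    simp only [map_mul, map_pow, subst_X, subst_C]
    obtain hl | rfl := (Nat.eq_zero_or_pos l).symm
    · obtain ⟨l, rfl⟩ : ∃ d, l = d + 1 := ⟨l - 1, by omega⟩
      refine ⟨C r * (linForm (M 0) ^ i * linForm (M 1) ^ j * linForm (M 2) ^ l), 0, 0, 0, ?_, ?_⟩
      · have := (((hx.pow i).mul (hy.pow j)).mul (hz.pow l)).C_mul r
        convert this using 1
        omega
      · convert dvd_zero G using 1
        simp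
        ring
    · match i with
      | 0 => exact ⟨0, r, 0, 0, isHomogeneous_zero _ _ _, by simp⟩
      | 1 =>
        refine ⟨0, 0, r, 0, isHomogeneous_zero _ _ _, ?_⟩
        rw [show 1 + j + 0 - 1 = j by omega]
        convert dvd_zero G using 1
        simp
        ring
      | 2 =>
        refine ⟨0, 0, 0, r, isHomogeneous_zero _ _ _, ?_⟩
        rw [show 2 + j + 0 - 2 = j by omega]
        convert dvd_zero G using 1
        simp
        ring
      | i + 3 =>
        refine ⟨C r * (linForm (M 0) ^ i * linForm (M 1) ^ j * (linForm (M 1) * linForm (M 1) -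
          C a * (linForm (M 0) * linForm (M 0)) - C b * (linForm (M 0) * linForm (M 2)) -
          C c * (linForm (M 2) * linForm (M 2)))), 0, 0, 0, ?_, ?_⟩
        · have := (((hx.pow i).mul (hy.pow j)).mul ((((hy.mul hy).sub ((hx.mul hx).C_mul a)).sub
            ((hx.mul hz).C_mul b)).sub ((hz.mul hz).C_mul c))).C_mul r
          convert this using 1
          omega
        · refine Dvd.intro (-(C r * (linForm (M 0) ^ i * linForm (M 1) ^ j))) ?_
          conv_lhs => rw [hW.equation]
          simp
          ring

/-- A form vanishing to order three at infinity is divisible by the line at infinity. -/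
lemma IsInfinity.exists_eq_mul_z {O : Points G} (hW : IsWeierstrass G M a b c)
    (hO : IsInfinity M O) {n : ℕ} {A : MvPolynomial (Fin 3) k} (hA : A.IsHomogeneous n)
    (h : VanishesToOrder G A O 3) :
    ∃ B : MvPolynomial (Fin 3) k, B.IsHomogeneous (n - 1) ∧ G ∣ A - linForm (M 2) * B := by
  obtain ⟨B, c₀, c₁, c₂, hB, hd⟩ := hW.normal_form hA
  have hz := hO.isLineDivisor hW
  have hzO : VanishesToOrder G (linForm (M 2)) O 3 :=
    (NonzeroForm.vanishesToOrder_iff hW.smooth hW.prime ⟨⟨1, hz.homogeneous⟩, hz.not_dvd⟩ O 3).2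
      (hO.ord_z hW).ge
  obtain ⟨hx, hxO⟩ := hO.ord_x hW
  have hxx := ord_mul hW.smooth hW.prime hx hx O
  have hyO := hO.y_ne hW
  have hr : VanishesToOrder G (C c₀ * linForm (M 1) ^ n +
      C c₁ * linForm (M 1) ^ (n - 1) * linForm (M 0) +
      C c₂ * linForm (M 1) ^ (n - 2) * (linForm (M 0) * linForm (M 0))) O 3 := by
    convert (h.congr hd).add (hzO.mul_left (-B)) using 1
    ring
  -- The remaining terms in `1, x, x²` are removed in this order: `y` is nonzero at `O`, `x` has
  -- order at most one and `x²` at most two, while the sum vanishes to order three.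
  have h0 : c₀ = 0 := by
    have := hr.eval_eq_zero hW.prime hW.smooth
    simpa [hO.x_eq, -eval_linForm, hyO] using this
  subst h0
  have h1 : c₁ = 0 := by
    by_contra h1
    have : VanishesToOrder G (linForm (M 0)) O 3 := by
      refine VanishesToOrder.of_mul_left (W := C c₁ * linForm (M 1) ^ (n - 1) +
        C c₂ * linForm (M 1) ^ (n - 2) * linForm (M 0)) ?_ ?_
      · convert hr using 1
        simp
        ring
      · simp [hO.x_eq, -eval_linForm, hyO, h1]
    rw [hx.vanishesToOrder_iff hW.smooth hW.prime] at this
    omega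
  subst h1
  have h2 : c₂ = 0 := by
    by_contra h2
    have : VanishesToOrder G (linForm (M 0) * linForm (M 0)) O 3 := by
      refine VanishesToOrder.of_mul_left (W := C c₂ * linForm (M 1) ^ (n - 2)) ?_ ?_
      · convert hr using 1
        simp
      · simp [-eval_linForm, hyO, h2]
    rw [(hx.mul hW.prime hx).vanishesToOrder_iff hW.smooth hW.prime] at this
    omega
  subst h2
  exact ⟨B, hB, by simpa using hd⟩

lemma IsInfinity.exists_eq_mul_z_pow {O : Points G} (hW : IsWeierstrass G M a b c)
    (hO : IsInfinity M O) (N : ℕ) {n : ℕ} {A : MvPolynomial (Fin 3) k} (hA : A.IsHomogeneous n)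
    (hA0 : ¬ G ∣ A) (h : 3 * N ≤ ord G A O) :
    ∃ B : MvPolynomial (Fin 3) k, B.IsHomogeneous (n - N) ∧ G ∣ A - linForm (M 2) ^ N * B := by
  induction N generalizing n A with
  | zero => exact ⟨A, by simpa using hA, by simp⟩
  | succ N ih =>
    have hz := hO.isLineDivisor hW
    obtain ⟨B, hB, hd⟩ := hO.exists_eq_mul_z hW hA
      ((NonzeroForm.vanishesToOrder_iff hW.smooth hW.prime ⟨⟨n, hA⟩, hA0⟩ O 3).2 (by omega))
    have hB0 : ¬ G ∣ B := fun hB0 => hA0 <| by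
      simpa using dvd_add hd (hB0.mul_left (linForm (M 2)))
    have hord := ord_congr hd (O : Plane k)
    rw [ord_mul hW.smooth hW.prime ⟨⟨1, hz.homogeneous⟩, hz.not_dvd⟩ ⟨⟨_, hB⟩, hB0⟩,
      hO.ord_z hW] at hord
    obtain ⟨B', hB', hd'⟩ := ih hB hB0 (by omega)
    refine ⟨B', by rwa [show n - (N + 1) = n - 1 - N by omega], ?_⟩
    convert dvd_add hd (hd'.mul_left (linForm (M 2))) using 1
    ring

/-! ### Noether's theorem and linear equivalence -/

lemma exists_homogeneous_of_dvd_sub {σ : Type*} {n d e : ℕ} {G A B V : MvPolynomial σ k}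
    (hG : G.IsHomogeneous e) (hA : A.IsHomogeneous n) (hB : B.IsHomogeneous d)
    (h : G ∣ A - B * V) :
    ∃ W : MvPolynomial σ k, W.IsHomogeneous (n - d) ∧ G ∣ A - B * W := by
  obtain ⟨W, hW⟩ := h
  have := congrArg (homogeneousComponent n) hW
  rw [map_sub, homogeneousComponent_mul hB, homogeneousComponent_mul hG,
    homogeneousComponent_of_mem hA, if_pos rfl] at this
  refine ⟨if d ≤ n then homogeneousComponent (n - d) V else 0, ?_, ?_⟩
  · split_ifs
    · exact homogeneousComponent_isHomogeneous _ V
    · exact isHomogeneous_zero _ _ _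
  · rw [mul_ite, mul_zero, this]
    split_ifs
    · exact dvd_mul_right _ _
    · exact dvd_zero _

/-- Locally, the form with the greater order of vanishing is a multiple of the other. -/
lemma exists_local_multiple (hG : IsSmoothCubic G) (hp : Prime G) {A B : MvPolynomial (Fin 3) k}
    (hA : NonzeroForm G A) (hB : NonzeroForm G B) {P : Points G} (h : ord G B P ≤ ord G A P) :
    ∃ U V : MvPolynomial (Fin 3) k, eval P.vec U ≠ 0 ∧ G ∣ U * A - V * B := by
  obtain ⟨t, ht⟩ := exists_isUniformizer hG P
  obtain ⟨U, V, hU, -, hUV⟩ := hA.hasOrder hG hp ht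
  obtain ⟨U', V', -, hV', hUV'⟩ := hB.hasOrder hG hp ht
  obtain ⟨n, hn⟩ := Nat.exists_eq_add_of_le h
  refine ⟨V' * U, V * U' * t ^ n, by simp [hU, hV'], ?_⟩
  convert dvd_sub (hUV.mul_left V') (hUV'.mul_left (V * t ^ n)) using 1
  rw [hn]
  ring

/-- Max Noether's theorem: a form vanishing to at least the order of `B` at each point of the
curve is a multiple of `B` modulo the equation of the curve. -/
theorem IsWeierstrass.exists_eq_mul [IsAlgClosed k] (hW : IsWeierstrass G M a b c) {d e : ℕ}
    {A B : MvPolynomial (Fin 3) k} (hA : A.IsHomogeneous (e + d)) (hB : B.IsHomogeneous d)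
    (hA0 : ¬ G ∣ A) (hB0 : ¬ G ∣ B) (h : ∀ P : Points G, ord G B P ≤ ord G A P) :
    ∃ D : MvPolynomial (Fin 3) k, D.IsHomogeneous e ∧ G ∣ A - B * D := by
  have hG := hW.smooth
  have hp := hW.prime
  obtain ⟨O, hO⟩ := hW.exists_isInfinity
  have hz := hO.isLineDivisor hW
  set z := linForm (M 2) with hzdef
  have nz : NonzeroForm G z := ⟨⟨1, hz.homogeneous⟩, hz.not_dvd⟩
  -- The colon ideal `(B, G) : A`.
  let J : Ideal (MvPolynomial (Fin 3) k) :=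
    Submodule.comap (LinearMap.toSpanSingleton _ _ A) (Ideal.span {B, G})
  have hJ : ∀ U, U ∈ J ↔ ∃ V, G ∣ U * A - B * V := fun U => by
    rw [Submodule.mem_comap, LinearMap.toSpanSingleton_apply, smul_eq_mul, Ideal.mem_span_pair]
    constructor
    · rintro ⟨V, W, h⟩
      exact ⟨V, W, by rw [← h]; ring⟩
    · rintro ⟨V, W, h⟩
      exact ⟨V, W, by linear_combination -h⟩
  -- By the Nullstellensatz it suffices that `J` has no zero but the origin. A nonzero zero `v` lies
  -- on the curve since `G ∈ J`; there `A` is locally a multiple of `B`, and the denominator, made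
  -- homogeneous, is an element of `J` not vanishing at `v`.
  have hzJ : z ∈ J.radical := by
    rw [← vanishingIdeal_zeroLocus_eq_radical (K := k), mem_vanishingIdeal_iff]
    intro v hv
    rw [mem_zeroLocus_iff] at hv
    simp only [aeval_eq_eval] at hv ⊢
    by_cases hv0 : v = 0
    · subst hv0
      rw [hzdef, eval_linForm, dotProduct_zero]
    · exfalso
      have hvG : eval v G = 0 := hv G ((hJ G).2 ⟨0, by simp⟩)
      obtain ⟨μ, hμ⟩ := Projectivization.exists_smul_eq_mk_rep k v hv0
      let P : Points G := ⟨Projectivization.mk k v hv0, by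
        change eval _ G = 0
        rw [← hμ, Units.smul_def, eval_smul_of_isHomogeneous hG.homogeneous, hvG, mul_zero]⟩
      obtain ⟨U, V, hU, hUV⟩ := exists_local_multiple hG hp ⟨⟨_, hA⟩, hA0⟩ ⟨⟨_, hB⟩, hB0⟩ (h P)
      obtain ⟨n, U, V, hUh, -, hU, hUV⟩ := exists_homogeneous_relation hG.homogeneous hA hB hU hUV
      have hvU : eval v U = 0 := hv U ((hJ U).2 ⟨V, by rwa [mul_comm B]⟩)
      refine hU ?_
      change eval (Projectivization.mk k v hv0).rep U = 0
      rw [← hμ, Units.smul_def, eval_smul_of_isHomogeneous hUh, hvU, mul_zero]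
  obtain ⟨N, hN⟩ := hzJ
  obtain ⟨V, hV⟩ := (hJ _).1 hN
  have hzN := hz.homogeneous.pow N
  rw [one_mul] at hzN
  obtain ⟨D, hD, hAD⟩ := exists_homogeneous_of_dvd_sub hG.homogeneous (hzN.mul hA) hB hV
  rw [show N + (e + d) - d = N + e by omega] at hD
  have nzN : ∀ N, ¬ G ∣ z ^ N := fun N h => hz.not_dvd (hp.dvd_of_dvd_pow h)
  have hordN : ∀ N, ord G (z ^ N) O = 3 * N := fun N => by
    induction N with
    | zero => exact ord_eq_zero hG hp (by simp)
    | succ N ih =>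
      rw [pow_succ, ord_mul hG hp ⟨⟨_, hz.homogeneous.pow N⟩, nzN N⟩ nz, ih, hO.ord_z hW]
      ring
  have hzA : ¬ G ∣ z ^ N * A := fun h => (hp.dvd_or_dvd h).elim (nzN N) hA0
  have hD0 : ¬ G ∣ D := fun hD0 => hzA <| by
    simpa using dvd_add hAD (hD0.mul_left B)
  have hord := ord_congr hAD (O : Plane k)
  rw [ord_mul hG hp ⟨⟨_, hzN⟩, nzN N⟩ ⟨⟨_, hA⟩, hA0⟩, ord_mul hG hp ⟨⟨_, hB⟩, hB0⟩ ⟨⟨_, hD⟩, hD0⟩,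
    hordN] at hord
  -- Now `z^N A ≡ B D`. Comparing orders at `O` gives `ord D ≥ 3N`, so `z^N` can be divided out of
  -- `D`.
  have hle := h O
  obtain ⟨D', hD', hDD'⟩ := hO.exists_eq_mul_z_pow hW N hD hD0 (by omega)
  rw [show N + e - N = e by omega] at hD'
  refine ⟨D', hD', (hp.dvd_or_dvd ?_).resolve_left (nzN N)⟩
  convert dvd_add hAD (hDD'.mul_left B) using 1
  ring

/-- A linear form vanishing to order two at infinity defines the line at infinity. -/
lemma IsInfinity.ord_linear {O : Points G} (hW : IsWeierstrass G M a b c) (hO : IsInfinity M O)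
    {l : MvPolynomial (Fin 3) k} (hl : l.IsHomogeneous 1) (hl0 : ¬ G ∣ l) (h : 2 ≤ ord G l O)
    (P : Points G) : (ord G l P : ℤ) =
      (Finsupp.single O 1 + Finsupp.single O 1 + Finsupp.single O 1 : Divisor G) P := by
  have hG := hW.smooth
  have hp := hW.prime
  have hz := hO.isLineDivisor hW
  have nz : NonzeroForm G (linForm (M 2)) := ⟨⟨1, hz.homogeneous⟩, hz.not_dvd⟩
  obtain ⟨hx, hxO⟩ := hO.ord_x hW
  have hv := (NonzeroForm.vanishesToOrder_iff hG hp ⟨⟨1, hl⟩, hl0⟩ O 2).2 h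
  obtain ⟨α, β, γ, rfl⟩ := hW.linear hl
  have hβ : β = 0 := by
    have := hv.eval_eq_zero hp hG
    simpa [hO.x_eq, hO.z_eq, -eval_linForm, hO.y_ne hW] using this
  subst hβ
  have hα : α = 0 := by
    by_contra hα
    have h2 : VanishesToOrder G (C α * linForm (M 0)) O 2 := by
      convert hv.add (((nz.vanishesToOrder_iff hG hp O 2).2
        (by rw [hO.ord_z hW]; norm_num)).mul_left (C (-γ))) using 1
      simp
    have := (hx.vanishesToOrder_iff hG hp O 2).1 (h2.of_mul_left (by simpa using hα))
    omega
  subst hα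
  rw [hz.eq_ord]
  have hγ : γ ≠ 0 := by
    rintro rfl
    simp at hl0
  have n : NonzeroForm G (C γ : MvPolynomial (Fin 3) k) := by
    refine ⟨⟨0, isHomogeneous_C _ _⟩, fun hd => hl0 ?_⟩
    simpa using hd.mul_right (linForm (M 2))
  have : C 0 * linForm (M 0) + C 0 * linForm (M 1) + C γ * linForm (M 2) =
      C γ * linForm (M 2) := by simp
  rw [this, ord_mul hG hp n nz, ord_eq_zero hG hp (by simpa using hγ), zero_add]

/-- By Noether's theorem `A ≡ B l` with `l` linear of divisor `[S] + n[O]`. As `n ≥ 2`, this line is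
the tangent at infinity, whose divisor is `3[O]`. -/
lemma IsInfinity.eq_of_ord_eq [IsAlgClosed k] {O S : Points G} (hW : IsWeierstrass G M a b c)
    (hO : IsInfinity M O) {d : ℕ} {A B : MvPolynomial (Fin 3) k} (hA : A.IsHomogeneous (1 + d))
    (hB : B.IsHomogeneous d) (hA0 : ¬ G ∣ A) (hB0 : ¬ G ∣ B) {n : ℤ} (hn : 2 ≤ n)
    (h : ∀ P : Points G, (ord G A P : ℤ) =
      ord G B P + (Finsupp.single S 1 + Finsupp.single O n : Divisor G) P) : S = O ∧ n = 2 := by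
  classical
  have hG := hW.smooth
  have hp := hW.prime
  simp only [Finsupp.add_apply, Finsupp.single_apply] at h
  obtain ⟨l, hl, hAl⟩ := hW.exists_eq_mul hA hB hA0 hB0 fun P => by
    have := h P
    split_ifs at this <;> omega
  have hl0 : ¬ G ∣ l := fun h => hA0 <| by
    simpa using dvd_add hAl (h.mul_left B)
  have hord : ∀ P : Points G, (ord G l P : ℤ) = (if S = P then 1 else 0) + if O = P then n else 0 :=
    fun P => by
      have h1 := ord_congr hAl (P : Plane k)
      rw [ord_mul hG hp ⟨⟨_, hB⟩, hB0⟩ ⟨⟨_, hl⟩, hl0⟩] at h1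
      have := h P
      omega
  have h3 := hO.ord_linear hW hl hl0 (by
    have := hord O
    rw [if_pos rfl] at this
    split_ifs at this <;> omega)
  simp only [Finsupp.add_apply, Finsupp.single_apply, hord] at h3
  by_cases hS : S = O
  · subst hS
    have := h3 S
    simp at this
    exact ⟨rfl, by omega⟩
  · have := h3 S
    simp [Ne.symm hS] at this

lemma IsWeierstrass.exists_opposite (hW : IsWeierstrass G M a b c) {O : Points G}
    (hO : IsInfinity M O) (P : Points G) : ∃ (Q : Points G) (l : MvPolynomial (Fin 3) k),
      IsLineDivisor l (Finsupp.single O 1 + Finsupp.single P 1 + Finsupp.single Q 1) := by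
  rcases hW.isInfinity_or_hasCoords P with hP | ⟨r, s, hP⟩
  · obtain rfl := hP.eq hW hO
    exact ⟨P, _, hP.isLineDivisor hW⟩
  · obtain ⟨Q, hQ⟩ := hW.exists_hasCoords (r := r) (s := -s) (by rw [neg_sq]; exact hP.equation hW)
    exact ⟨Q, _, hP.isLineDivisor_vertical hW hO hQ⟩

/-- The degree and the sum of a principal divisor of the form `[S] + n [O]`. -/
theorem IsInfinity.eq_of_principal [IsAlgClosed k] {O S : Points G} (hW : IsWeierstrass G M a b c)
    (hO : IsInfinity M O) {n : ℤ}
    (h : Finsupp.single S 1 + Finsupp.single O n ∈ principalDivisors G) : S = O ∧ n = -1 := by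
  classical
  have hG := hW.smooth
  have hp := hW.prime
  obtain ⟨d, A, B, hA, hB, nA, nB, hAB⟩ := isDivisorOfFunction_of_mem hG hp h
  simp only [Finsupp.add_apply, Finsupp.single_apply] at hAB
  have hz := hO.isLineDivisor hW
  have nmul : ∀ {A B : MvPolynomial (Fin 3) k}, ¬ G ∣ A → ¬ G ∣ B → ¬ G ∣ A * B :=
    fun hA hB h => (hp.dvd_or_dvd h).elim hA hB
  by_cases hn : -1 ≤ n
  -- Multiplying `A` by `z` adds `3[O]`, which makes the coefficient of `O` at least two.
  · obtain ⟨hS, h2⟩ := hO.eq_of_ord_eq hW (S := S) (n := n + 3) (hz.homogeneous.mul hA) hB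
      (nmul hz.not_dvd nA) nB (by omega) fun P => by
        rw [ord_mul hG hp ⟨⟨_, hz.homogeneous⟩, hz.not_dvd⟩ ⟨⟨_, hA⟩, nA⟩]
        have h1 := hAB P
        have h2 := hz.eq_ord P
        simp only [Finsupp.add_apply, Finsupp.single_apply] at h1 h2 ⊢
        push_cast
        rw [← h2]
        split_ifs at h1 h2 ⊢ <;> omega
    exact ⟨hS, by omega⟩
  -- The function is inverted: with `l` cutting out `[O] + [S] + [T]`, the divisor of `l B / A` is
  -- `[T] + (1 - n)[O]`. Then `1 - n = 2`, against `n < -1`.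
  · obtain ⟨T, l, hl⟩ := hW.exists_opposite hO S
    obtain ⟨hT, h2⟩ := hO.eq_of_ord_eq hW (S := T) (n := 1 - n) (hl.homogeneous.mul hB) hA
      (nmul hl.not_dvd nB) nA (by omega) fun P => by
        rw [ord_mul hG hp ⟨⟨_, hl.homogeneous⟩, hl.not_dvd⟩ ⟨⟨_, hB⟩, nB⟩]
        have h1 := hAB P
        have h2 := hl.eq_ord P
        simp only [Finsupp.add_apply, Finsupp.single_apply] at h1 h2 ⊢
        push_cast
        rw [← h2]
        split_ifs at h1 h2 ⊢ <;> omega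
    omega

/-! ### The group law -/

lemma diffClass_eq (P Q : Points G) : diffClass G P Q =
    divisorClass (Finsupp.single Q 1) - divisorClass (Finsupp.single P 1) := rfl

lemma divisorClass_add (D D' : Divisor G) :
    divisorClass (D + D') = divisorClass D + divisorClass D' := rfl

lemma IsLineDivisor.add_eq_zero {O P Q R : Points G} {l : MvPolynomial (Fin 3) k}
    (hW : IsWeierstrass G M a b c) (hO : IsInfinity M O)
    (h : IsLineDivisor l (Finsupp.single P 1 + Finsupp.single Q 1 + Finsupp.single R 1)) :
    diffClass G O P + diffClass G O Q + diffClass G O R = 0 := by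
  have := h.divisorClass_eq (hO.isLineDivisor hW)
  simp only [divisorClass_add] at this
  simp only [diffClass_eq]
  rw [← sub_eq_zero] at this
  rw [← this]
  abel

lemma IsInfinity.eq_of_diffClass_eq_zero [IsAlgClosed k] {O S : Points G}
    (hW : IsWeierstrass G M a b c) (hO : IsInfinity M O) (h : diffClass G O S = 0) : S = O := by
  refine (hO.eq_of_principal hW (n := -1) ?_).1
  have := (QuotientAddGroup.eq_zero_iff _).1 h
  rwa [sub_eq_add_neg, ← Finsupp.single_neg] at this

/-- The line through two affine points which are not opposite. -/
lemma HasCoords.exists_isLineDivisor {P Q : Points G} {r₁ s₁ r₂ s₂ : k} (h2 : (2 : k) ≠ 0)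
    (hW : IsWeierstrass G M a b c) (hP : HasCoords M P r₁ s₁) (hQ : HasCoords M Q r₂ s₂)
    (hne : ¬ (r₁ = r₂ ∧ s₂ = -s₁)) : ∃ (R : Points G) (r₃ s₃ : k) (l : MvPolynomial (Fin 3) k),
      HasCoords M R r₃ s₃ ∧
        IsLineDivisor l (Finsupp.single P 1 + Finsupp.single Q 1 + Finsupp.single R 1) := by
  have e₁ := hP.equation hW
  have e₂ := hQ.equation hW
  -- The third abscissa is `m² - a - r₁ - r₂` by the sum of the roots. Only the linear Vieta
  -- relation is left to check; the constant one follows since `r₁` is a root.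
  suffices ∃ m e : k, s₁ = m * r₁ + e ∧ s₂ = m * r₂ + e ∧
      b - 2 * m * e = r₁ * r₂ + (r₁ + r₂) * (m ^ 2 - a - r₁ - r₂) by
    obtain ⟨m, e, rfl, rfl, hb⟩ := this
    have hc : e ^ 2 - c = r₁ * r₂ * (m ^ 2 - a - r₁ - r₂) := by
      linear_combination e₁ + r₁ * hb
    obtain ⟨R, hR⟩ := hW.exists_hasCoords (r := m ^ 2 - a - r₁ - r₂)
      (s := m * (m ^ 2 - a - r₁ - r₂) + e) (by
        linear_combination hc - (m ^ 2 - a - r₁ - r₂) * hb)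
    exact ⟨R, _, _, _, hR, isLineDivisor_chord hW hP hQ hR (by ring)
      (by linear_combination hb) hc⟩
  by_cases hr : r₁ = r₂
  · subst hr
    have hs : s₂ = s₁ := by
      have : (s₂ - s₁) * (s₂ + s₁) = 0 := by linear_combination e₂ - e₁
      rcases mul_eq_zero.1 this with h | h
      · exact sub_eq_zero.1 h
      · exact absurd ⟨rfl, eq_neg_of_add_eq_zero_left h⟩ hne
    subst hs
    have hs : s₂ ≠ 0 := fun h => hne ⟨rfl, by simp [h]⟩
    -- The slope of the tangent.
    obtain ⟨m, hm⟩ : ∃ m, 2 * m * s₂ = 3 * r₁ ^ 2 + 2 * a * r₁ + b :=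
      ⟨(3 * r₁ ^ 2 + 2 * a * r₁ + b) / (2 * s₂), by field_simp⟩
    exact ⟨m, s₂ - m * r₁, by ring, by ring, by linear_combination -hm⟩
  · have hr : r₂ - r₁ ≠ 0 := sub_ne_zero.2 (Ne.symm hr)
    obtain ⟨m, hm⟩ : ∃ m, m * (r₂ - r₁) = s₂ - s₁ := ⟨(s₂ - s₁) / (r₂ - r₁), by field_simp⟩
    obtain rfl : s₂ = s₁ + m * (r₂ - r₁) := by linear_combination -hm
    refine ⟨m, s₁ - m * r₁, by ring, by ring, mul_right_cancel₀ hr ?_⟩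
    linear_combination e₁ - e₂

/-- The chord and tangent construction: classes of the form `[P] - [O]` form a subgroup. -/
def pointClasses (h2 : (2 : k) ≠ 0) (hW : IsWeierstrass G M a b c) {O : Points G}
    (hO : IsInfinity M O) : AddSubgroup (Pic G) where
  carrier := Set.range (diffClass G O)
  zero_mem' := ⟨O, diffClass_self G O⟩
  neg_mem' := by
    rintro _ ⟨P, rfl⟩
    obtain ⟨Q, l, hQ⟩ := hW.exists_opposite hO P
    have := hQ.add_eq_zero hW hO
    rw [diffClass_self, zero_add] at this
    exact ⟨Q, (neg_eq_of_add_eq_zero_right this).symm⟩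
  add_mem' := by
    rintro _ _ ⟨P, rfl⟩ ⟨Q, rfl⟩
    rcases hW.isInfinity_or_hasCoords P with hP | ⟨r₁, s₁, hP⟩
    · obtain rfl := hP.eq hW hO
      exact ⟨Q, by rw [diffClass_self, zero_add]⟩
    rcases hW.isInfinity_or_hasCoords Q with hQ | ⟨r₂, s₂, hQ⟩
    · obtain rfl := hQ.eq hW hO
      exact ⟨P, by rw [diffClass_self, add_zero]⟩
    by_cases hne : r₁ = r₂ ∧ s₂ = -s₁
    · obtain ⟨rfl, rfl⟩ := hne
      have := (hP.isLineDivisor_vertical hW hO hQ).add_eq_zero hW hO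
      rw [diffClass_self, zero_add] at this
      exact ⟨O, by rw [this, diffClass_self]⟩
    · obtain ⟨R, _, _, l, -, hR⟩ := hP.exists_isLineDivisor h2 hW hQ hne
      obtain ⟨S, l', hS⟩ := hW.exists_opposite hO R
      have h := hR.add_eq_zero hW hO
      have h' := hS.add_eq_zero hW hO
      rw [diffClass_self, zero_add] at h'
      exact ⟨S, by rw [eq_neg_of_add_eq_zero_right h', eq_neg_of_add_eq_zero_left h]⟩

lemma IsInfinity.exists_class_eq (h2 : (2 : k) ≠ 0) (hW : IsWeierstrass G M a b c) {O : Points G}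
    (hO : IsInfinity M O) (x : Pic G) : ∃ (S : Points G) (n : ℤ),
      x = diffClass G O S + n • divisorClass (Finsupp.single O 1) := by
  obtain ⟨D, rfl⟩ := QuotientAddGroup.mk_surjective x
  suffices ∃ n : ℤ, divisorClass D - n • divisorClass (Finsupp.single O 1) ∈
      pointClasses h2 hW hO by
    obtain ⟨n, S, hS⟩ := this
    exact ⟨S, n, by rw [hS, sub_add_cancel]; rfl⟩
  induction D using Finsupp.induction_linear with
  | zero => exact ⟨0, by rw [zero_zsmul, sub_zero]; exact zero_mem _⟩
  | add D D' hD hD' =>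
    obtain ⟨n, hn⟩ := hD
    obtain ⟨n', hn'⟩ := hD'
    refine ⟨n + n', ?_⟩
    rw [divisorClass_add, add_zsmul, add_sub_add_comm]
    exact add_mem hn hn'
  | single P n =>
    refine ⟨n, ?_⟩
    have : divisorClass (Finsupp.single P n) = n • divisorClass (Finsupp.single P (1 : ℤ)) := by
      have : (Finsupp.single P n : Divisor G) = n • Finsupp.single P (1 : ℤ) := by simp
      rw [this]
      rfl
    rw [this, ← zsmul_sub]
    exact zsmul_mem (⟨P, rfl⟩ : diffClass G O P ∈ pointClasses h2 hW hO) n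

/-- Write `x = [S] - [O] + n[O]`. Then `2x` is the class of `[S'] + (2n - 1)[O]` for some `S'`, and
its vanishing forces `n = 0`. If `S` were affine with `y ≠ 0`, its tangent would meet the curve
again at an affine point of class zero, which would be `O`. -/
lemma IsInfinity.exists_two_torsion [IsAlgClosed k] (h2 : (2 : k) ≠ 0)
    (hW : IsWeierstrass G M a b c)
    {O : Points G} (hO : IsInfinity M O) {x : Pic G} (hx : (2 : ℕ) • x = 0) :
    ∃ S : Points G, x = diffClass G O S ∧ (S = O ∨ ∃ r, HasCoords M S r 0) := by
  obtain ⟨S, n, rfl⟩ := hO.exists_class_eq h2 hW x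
  obtain ⟨S', hS'⟩ : diffClass G O S + diffClass G O S ∈ pointClasses h2 hW hO :=
    add_mem ⟨S, rfl⟩ ⟨S, rfl⟩
  have hprin : Finsupp.single S' 1 + Finsupp.single O (2 * n - 1) ∈ principalDivisors G := by
    refine (QuotientAddGroup.eq_zero_iff _).1 ?_
    have hO' : divisorClass (Finsupp.single O (2 * n - 1)) =
        (2 * n - 1) • divisorClass (Finsupp.single O (1 : ℤ)) := by
      have : (Finsupp.single O (2 * n - 1) : Divisor G) =
          (2 * n - 1) • Finsupp.single O (1 : ℤ) := by
        simp
      rw [this]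
      rfl
    change divisorClass (Finsupp.single S' 1 + Finsupp.single O (2 * n - 1)) = 0
    rw [divisorClass_add, hO']
    rw [diffClass_eq, sub_eq_iff_eq_add] at hS'
    rw [hS', ← hx, two_nsmul, sub_zsmul, two_mul, add_zsmul, one_zsmul]
    abel
  obtain ⟨-, hn⟩ := hO.eq_of_principal hW hprin
  obtain rfl : n = 0 := by omega
  rw [zero_zsmul, add_zero] at hx ⊢
  refine ⟨S, rfl, ?_⟩
  rcases hW.isInfinity_or_hasCoords S with h | ⟨r, s, h⟩
  · exact Or.inl (h.eq hW hO)
  · refine Or.inr ⟨r, ?_⟩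
    suffices s = 0 by rwa [this] at h
    by_contra hs
    obtain ⟨R, r₃, s₃, l, hR, hl⟩ := h.exists_isLineDivisor h2 hW h fun hh => hs <| by
      have : 2 * s = 0 := by linear_combination hh.2
      exact (mul_eq_zero.1 this).resolve_left h2
    have := hl.add_eq_zero hW hO
    rw [← two_nsmul, hx, zero_add] at this
    obtain rfl := hO.eq_of_diffClass_eq_zero hW this
    exact hR.not_isInfinity hO

/-- For distinct affine `Q` and `Q'`, the line joining `Q` to the opposite `T` of `Q'` is not
vertical. Its third point is affine, yet has class zero when the classes of `Q` and `Q'` agree. -/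
lemma IsWeierstrass.diffClass_injective [IsAlgClosed k] (h2 : (2 : k) ≠ 0)
    (hW : IsWeierstrass G M a b c)
    {P Q Q' : Points G} (h : diffClass G P Q = diffClass G P Q') : Q = Q' := by
  obtain ⟨O, hO⟩ := hW.exists_isInfinity
  have h : diffClass G O Q = diffClass G O Q' := by
    rw [← diffClass_add G O P Q, h, diffClass_add]
  rcases hW.isInfinity_or_hasCoords Q' with hQ' | ⟨r', s', hQ'⟩
  · obtain rfl := hQ'.eq hW hO
    rw [diffClass_self] at h
    exact hO.eq_of_diffClass_eq_zero hW h
  rcases hW.isInfinity_or_hasCoords Q with hQ | ⟨r, s, hQ⟩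
  · obtain rfl := hQ.eq hW hO
    rw [diffClass_self] at h
    exact (hO.eq_of_diffClass_eq_zero hW h.symm).symm
  obtain ⟨T, hT⟩ := hW.exists_hasCoords (r := r') (s := -s') (by rw [neg_sq]; exact hQ'.equation hW)
  have hv := (hQ'.isLineDivisor_vertical hW hO hT).add_eq_zero hW hO
  rw [diffClass_self, zero_add, ← h] at hv
  by_cases hne : r = r' ∧ -s' = -s
  · obtain ⟨rfl, hs⟩ := hne
    obtain rfl := neg_injective hs
    exact hQ.eq hW hQ'
  · obtain ⟨R, _, _, l, hR, hl⟩ := hQ.exists_isLineDivisor h2 hW hT hne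
    have := hl.add_eq_zero hW hO
    rw [hv, zero_add] at this
    obtain rfl := hO.eq_of_diffClass_eq_zero hW this
    exact absurd hO hR.not_isInfinity

lemma IsWeierstrass.translate_eq [IsAlgClosed k] (h2 : (2 : k) ≠ 0)
    (hW : IsWeierstrass G M a b c) {β : Pic G}
    {P Q : Points G} (h : diffClass G P Q = β) : translate β P = Q := by
  have hex : ∃ q, diffClass G P q = β := ⟨Q, h⟩
  rw [translate, dif_pos hex]
  exact hW.diffClass_injective h2 (hex.choose_spec.trans h.symm)

/-! ### Translation by a point of order two -/

lemma IsWeierstrass.exists_shift (hW : IsWeierstrass G M a b c) {O B : Points G}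
    (hO : IsInfinity M O) {r : k} (hB : HasCoords M B r 0) :
    ∃ (M' : Matrix (Fin 3) (Fin 3) k) (a' b' : k), IsWeierstrass G M' a' b' 0 ∧
      IsInfinity M' O ∧ HasCoords M' B 0 0 := by
  set T : Matrix (Fin 3) (Fin 3) k := !![1, 0, -r; 0, 1, 0; 0, 0, 1] with hT
  have e0 : linForm ((T * M) 0) = linForm (M 0) - C r * linForm (M 2) := by
    rw [← subst_X, ← subst_subst, subst_X]
    simp [hT, linForm, Fin.sum_univ_three]
    ring
  have e1 : linForm ((T * M) 1) = linForm (M 1) := by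
    rw [← subst_X, ← subst_subst, subst_X]
    simp [hT, linForm, Fin.sum_univ_three]
  have e2 : linForm ((T * M) 2) = linForm (M 2) := by
    rw [← subst_X, ← subst_subst, subst_X]
    simp [hT, linForm, Fin.sum_univ_three]
  refine ⟨T * M, 3 * r + a, 3 * r ^ 2 + 2 * a * r + b, ⟨?_, ?_, hW.smooth⟩, ⟨?_, ?_⟩, ⟨?_, ?_, ?_⟩⟩
  · rw [Matrix.det_mul, hT, Matrix.det_fin_three]
    simpa using hW.det
  · have h := hB.equation hW
    obtain rfl : c = -(r ^ 3 + a * r ^ 2 + b * r) := by linear_combination -h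
    have hC2 : (C 2 : MvPolynomial (Fin 3) k) = 2 := map_ofNat C 2
    have hC3 : (C 3 : MvPolynomial (Fin 3) k) = 3 := map_ofNat C 3
    refine hW.equation.trans ?_
    simp only [weierstrass, map_sub, map_add, map_mul, map_pow, subst_X, subst_C, e0, e1, e2, hC2,
      hC3, map_neg, map_zero, map_ofNat]
    ring
  · rw [e0, map_sub, map_mul, hO.x_eq, hO.z_eq, mul_zero, sub_zero]
  · rw [e2, hO.z_eq]
  · rw [e2]
    exact hB.z_ne
  · rw [e0, map_sub, map_mul, hB.x_eq, eval_C, sub_self, zero_mul]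
  · rw [e1, hB.y_eq, zero_mul, zero_mul]

/-- The translate of an affine point by the point `(0, 0)` of order two. -/
lemma HasCoords.diffClass_translate (hW : IsWeierstrass G M a b 0) {O B P Q : Points G}
    (hO : IsInfinity M O) (hB : HasCoords M B 0 0) {r s : k} (hr : r ≠ 0) (hP : HasCoords M P r s)
    (hQ : HasCoords M Q (b / r) (-(b * s / r ^ 2))) : diffClass G P Q = diffClass G O B := by
  have hQe := hQ.equation hW
  have hPe := hP.equation hW
  -- `R` is the third point on the line `y = (s/r) x` through `P` and `B`, and `Q` is its opposite.
  obtain ⟨R, hR⟩ := hW.exists_hasCoords (r := b / r) (s := b * s / r ^ 2)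
    (by rw [← hQe, neg_sq])
  have hB' : HasCoords M B 0 (s / r * 0 + 0) := by simpa using hB
  have hP' : HasCoords M P r (s / r * r + 0) := by
    rwa [add_zero, div_mul_cancel₀ _ hr]
  have hR' : HasCoords M R (b / r) (s / r * (b / r) + 0) := by
    convert hR using 1
    field_simp
    ring
  have h1 := (isLineDivisor_chord hW hP' hB' hR' (by field_simp; linear_combination hPe)
    (by field_simp; ring) (by ring)).add_eq_zero hW hO
  have h2 := (hR.isLineDivisor_vertical hW hO hQ).add_eq_zero hW hO
  rw [diffClass_self, zero_add] at h2
  rw [← diffClass_add G P O Q, ← diffClass_neg, eq_neg_of_add_eq_zero_right h2,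
    eq_neg_of_add_eq_zero_right h1]
  abel

/-- Smoothness of the cubic `Y²Z = X (X² + a XZ + b Z²)`. -/
lemma IsWeierstrass.coeff_ne (hW : IsWeierstrass G M a b 0) (h2 : (2 : k) ≠ 0) :
    b ≠ 0 ∧ a ^ 2 ≠ 4 * b := by
  have hdet : IsUnit M⁻¹.det := Matrix.isUnit_nonsing_inv_det_iff.2 hW.det
  have hs := (hW.smooth.subst hdet).smooth
  rw [hW.eq, subst_subst, Matrix.mul_nonsing_inv M hW.det, subst_one] at hs
  constructor
  -- For `b = 0` the curve is singular at `(0, 0)`; for `a = 2r`, `b = r²` it is singular at `(-r,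
  -- 0)`.
  · rintro rfl
    obtain ⟨i, hi⟩ := hs ![0, 0, 1] (fun h => by simpa using congrFun h 2) (by simp [weierstrass])
    fin_cases i <;> simp [weierstrass, pderiv_X] at hi
  · intro h
    obtain ⟨r, rfl⟩ : ∃ r, a = 2 * r := ⟨a / 2, by field_simp⟩
    have h4 : (4 : k) ≠ 0 := by
      have : (4 : k) = 2 * 2 := by norm_num
      rw [this]
      exact mul_ne_zero h2 h2
    obtain rfl : b = r ^ 2 := mul_left_cancel₀ h4 (by linear_combination -h)
    obtain ⟨i, hi⟩ := hs ![-r, 0, 1] (fun h => by simpa using congrFun h 2)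
      (by simp [weierstrass]; ring)
    fin_cases i <;> simp [weierstrass, pderiv_X] at hi
    · exact hi (by ring)
    · exact hi (by ring)

/-! ### Translation and the chord construction -/

/-- Translation by the point `(0, 0)` of the cubic `Y²Z = X (X² + a XZ + b Z²)`. -/
lemma IsWeierstrass.translate_cases [IsAlgClosed k] (h2 : (2 : k) ≠ 0)
    (hW : IsWeierstrass G M a b 0) {O B : Points G} (hO : IsInfinity M O)
    (hB : HasCoords M B 0 0) (hβ : (2 : ℕ) • diffClass G O B = 0) (P : Points G) :
    diffClass G P (translate (diffClass G O B) P) = diffClass G O B ∧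
    (P = O ∧ translate (diffClass G O B) P = B ∨ P = B ∧ translate (diffClass G O B) P = O ∨
    ∃ r s, r ≠ 0 ∧ HasCoords M P r s ∧
      HasCoords M (translate (diffClass G O B) P) (b / r) (-(b * s / r ^ 2))) := by
  rcases hW.isInfinity_or_hasCoords P with hP | ⟨r, s, hP⟩
  · obtain rfl := hP.eq hW hO
    have : translate (diffClass G P B) P = B := hW.translate_eq h2 rfl
    rw [this]
    exact ⟨rfl, Or.inl ⟨rfl, rfl⟩⟩
  have heq := hP.equation hW
  by_cases hr : r = 0
  · subst hr
    have hs : s = 0 := pow_eq_zero_iff (n := 2) (by norm_num) |>.1 (by linear_combination heq)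
    subst hs
    obtain rfl := hP.eq hW hB
    have h : diffClass G P O = diffClass G O P := by
      rw [← diffClass_neg, neg_eq_iff_add_eq_zero, ← two_nsmul, hβ]
    rw [hW.translate_eq h2 h]
    exact ⟨h, Or.inr (Or.inl ⟨rfl, rfl⟩)⟩
  · obtain ⟨Q, hQ⟩ := hW.exists_hasCoords (r := b / r) (s := -(b * s / r ^ 2)) (by
      field_simp
      linear_combination b ^ 2 * heq)
    have h := HasCoords.diffClass_translate hW hO hB hr hP hQ
    rw [hW.translate_eq h2 h]
    exact ⟨h, Or.inr (Or.inr ⟨r, s, hr, hP, hQ⟩)⟩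

/-- The representative chosen by `Quotient.out` is `P` or `P + β`, according to the parity of `n`.
Translation exchanges the two, and the line through them is symmetric. -/
lemma chordMap_quotientMap [IsAlgClosed k] (h2 : (2 : k) ≠ 0) (hW : IsWeierstrass G M a b c)
    {β : Pic G} (hβ : (2 : ℕ) • β = 0) (P : Points G) :
    chordMap β (quotientMap β P) = lineThrough (P : Plane k) (translate β P) := by
  rw [chordMap]
  have hmem : diffClass G (quotientMap β P).out P ∈ AddSubgroup.zmultiples β :=
    Quotient.exact (Quotient.out_eq (quotientMap β P))
  generalize (quotientMap β P).out = Q at hmem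
  obtain ⟨n, hn⟩ := hmem
  have hn : n • β = diffClass G Q P := hn
  have hβ' : β + β = 0 := by rwa [two_nsmul] at hβ
  rcases Int.even_or_odd' n with ⟨m, rfl | rfl⟩
  · rw [mul_comm, mul_zsmul, two_zsmul, hβ', zsmul_zero, ← diffClass_self G Q] at hn
    rw [hW.diffClass_injective h2 hn]
  · rw [add_zsmul, mul_comm, mul_zsmul, two_zsmul, hβ', zsmul_zero, zero_add, one_zsmul] at hn
    have h : diffClass G P Q = β := by
      rw [← diffClass_neg, ← hn, neg_eq_iff_add_eq_zero, hβ']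
    rw [hW.translate_eq h2 h, hW.translate_eq h2 hn.symm]
    classical
    exact Projectivization.cross_comm _ _

/-! ### The dual plane -/

lemma dotProduct_eq_zero_iff_orthogonal {L P : Plane k} :
    L.rep ⬝ᵥ P.rep = 0 ↔ Projectivization.orthogonal L P := by
  rw [← Projectivization.orthogonal_mk L.rep_nonzero P.rep_nonzero, L.mk_rep, P.mk_rep]

lemma eq_lineThrough_iff {L P Q : Plane k} (h : P ≠ Q) :
    L = lineThrough P Q ↔ L.rep ⬝ᵥ P.rep = 0 ∧ L.rep ⬝ᵥ Q.rep = 0 := by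
  classical
  constructor
  · rintro rfl
    rw [dotProduct_eq_zero_iff_orthogonal, dotProduct_eq_zero_iff_orthogonal]
    exact ⟨Projectivization.cross_orthogonal_left h, Projectivization.cross_orthogonal_right h⟩
  · rintro ⟨h1, h2⟩
    have hl' : lineThrough P Q = Projectivization.mk k (crossProduct P.rep Q.rep)
        (fun h0 => h (by simpa using (Projectivization.mk_eq_mk_iff_crossProduct_eq_zero
          P.rep_nonzero Q.rep_nonzero).2 h0)) := by
      rw [← Projectivization.cross_mk_of_cross_ne_zero P.rep_nonzero Q.rep_nonzero]
      simp only [Projectivization.mk_rep, lineThrough]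
    rw [hl']
    nth_rewrite 1 [← L.mk_rep]
    rw [Projectivization.mk_eq_mk_iff_crossProduct_eq_zero]
    simp only [dotProduct, Fin.sum_univ_three] at h1 h2
    ext i
    fin_cases i <;> simp [cross_apply]
    · linear_combination (P.rep 0) * h2 - (Q.rep 0) * h1
    · linear_combination (P.rep 1) * h2 - (Q.rep 1) * h1
    · linear_combination (P.rep 2) * h2 - (Q.rep 2) * h1

/-- The coordinates of a line dual to the coordinates given by the rows of `M`. -/
def dualCoords (M : Matrix (Fin 3) (Fin 3) k) (L : Plane k) : Fin 3 → k := M⁻¹ᵀ *ᵥ L.rep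

lemma det_inv_transpose (hM : IsUnit M.det) : IsUnit M⁻¹ᵀ.det := by
  rw [Matrix.det_transpose]
  exact Matrix.isUnit_nonsing_inv_det_iff.2 hM

lemma dotProduct_rep (hM : IsUnit M.det) (L : Plane k) (P : Points G) :
    L.rep ⬝ᵥ P.vec = dualCoords M L 0 * eval P.vec (linForm (M 0)) +
      dualCoords M L 1 * eval P.vec (linForm (M 1)) +
      dualCoords M L 2 * eval P.vec (linForm (M 2)) := by
  have h : dualCoords M L ⬝ᵥ (M *ᵥ P.vec) = L.rep ⬝ᵥ P.vec := by
    rw [dualCoords, Matrix.mulVec_transpose, ← Matrix.dotProduct_mulVec, Matrix.mulVec_mulVec,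
      Matrix.nonsing_inv_mul M hM, Matrix.one_mulVec]
  rw [← h]
  simp [dotProduct, Fin.sum_univ_three, Matrix.mulVec]

lemma exists_dualCoords (hM : IsUnit M.det) {w : Fin 3 → k} (hw : w ≠ 0) :
    ∃ (L : Plane k) (μ : k), μ ≠ 0 ∧ dualCoords M L = μ • w := by
  have hdet := Matrix.isUnit_nonsing_inv_det_iff.2 (det_inv_transpose hM)
  have hne := mulVec_ne_zero hdet hw
  obtain ⟨μ, hμ⟩ := Projectivization.exists_smul_eq_mk_rep k _ hne
  refine ⟨Projectivization.mk k _ hne, μ, μ.ne_zero, ?_⟩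
  rw [dualCoords, ← hμ, Units.smul_def, Matrix.mulVec_smul, Matrix.mulVec_mulVec,
    Matrix.mul_nonsing_inv _ (det_inv_transpose hM), Matrix.one_mulVec]

lemma restrictToLine_subst (N : Matrix (Fin 3) (Fin 3) k) (H : MvPolynomial (Fin 3) k)
    (P Q : Plane k) : restrictToLine (subst N H) P Q =
      aeval (fun i => Polynomial.C ((N *ᵥ P.rep) i) + Polynomial.X * Polynomial.C ((N *ᵥ Q.rep) i))
        H := by
  rw [restrictToLine, ← AlgHom.comp_apply]
  congr 1
  ext1 i
  simp [linForm, Matrix.mulVec, dotProduct, Fin.sum_univ_three]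
  ring

/-! ### The cubic of chords -/

/-- The equation, in dual coordinates, of the lines through `p` and `p + (0, 0)`, where `p` runs
through the points of the cubic `Y²Z = X (X² + a XZ + b Z²)`. -/
def chordCubic (a b : k) : MvPolynomial (Fin 3) k :=
  X 2 ^ 3 - C (2 * b ^ 2) * (X 0 * X 1 ^ 2) - C b * (X 2 * X 0 ^ 2) + C (a * b) * (X 2 * X 1 ^ 2)

lemma chordCubic_isSmoothCubic (h2 : (2 : k) ≠ 0) (hb : b ≠ 0) (hab : a ^ 2 ≠ 4 * b) :
    IsSmoothCubic (chordCubic a b) where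
  homogeneous := by
    have h := isHomogeneous_X (R := k) (σ := Fin 3)
    exact ((((h 2).pow 3).sub (((h 0).mul ((h 1).pow 2)).C_mul _)).sub
      (((h 2).mul ((h 0).pow 2)).C_mul _)).add (((h 2).mul ((h 1).pow 2)).C_mul _)
  smooth v hv h0 := by
    by_contra! hc
    have d0 := hc 0
    have d1 := hc 1
    have d2 := hc 2
    simp [chordCubic, pderiv_X] at h0 d0 d1 d2
    refine hv ?_
    -- If `V ≠ 0`, the derivatives in `U` and `V` give `b V² = -W U` and `a W = 2b U`. With the
    -- equation this yields `W² = b U²`, hence `a² = 4b`.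
    have hV : v 1 = 0 := by
      by_contra hV
      have e1 : b * v 1 ^ 2 = -(v 2 * v 0) := by
        refine mul_left_cancel₀ (mul_ne_zero h2 hb) ?_
        linear_combination -d0
      have e2 : a * v 2 = 2 * b * v 0 := by
        refine mul_left_cancel₀ (mul_ne_zero (mul_ne_zero h2 hb) hV) ?_
        linear_combination d1
      have hprod : v 2 * v 0 ≠ 0 := fun h => by
        rw [h, neg_zero] at e1
        exact mul_ne_zero hb (pow_ne_zero 2 hV) e1
      have e3 : v 2 ^ 2 = b * v 0 ^ 2 := by
        refine mul_left_cancel₀ (left_ne_zero_of_mul hprod) ?_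
        linear_combination h0 + (2 * b * v 0 - a * v 2) * e1 + v 2 * v 0 * e2
      refine hab (mul_left_cancel₀ (mul_ne_zero hb (pow_ne_zero 2 (right_ne_zero_of_mul hprod))) ?_)
      linear_combination (a * v 2 + 2 * b * v 0) * e2 - a ^ 2 * e3
    rw [hV] at h0 d0 d1 d2
    have hUW : v 2 * v 0 = 0 := by
      refine mul_left_cancel₀ (mul_ne_zero h2 hb) ?_
      linear_combination -d0
    have hW : v 2 = 0 := by
      refine pow_eq_zero_iff (n := 3) (by norm_num) |>.1 ?_
      linear_combination h0 + b * v 0 * hUW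
    have hU : v 0 = 0 := by
      rw [hW] at d2
      refine pow_eq_zero_iff (n := 2) (by norm_num) |>.1 (mul_left_cancel₀ hb ?_)
      linear_combination -d2
    ext i
    fin_cases i
    · exact hU
    · exact hV
    · exact hW

lemma eval_chordCubic (v : Fin 3 → k) : eval v (chordCubic a b) =
    v 2 ^ 3 - 2 * b ^ 2 * (v 0 * v 1 ^ 2) - b * (v 2 * v 0 ^ 2) + a * b * (v 2 * v 1 ^ 2) := by
  simp [chordCubic]

/-- The chords of the pairs `{p, p + (0, 0)}` lie on the cubic of chords. -/
lemma chordCubic_eq_zero_of_incident (h2 : (2 : k) ≠ 0) (hb : b ≠ 0) (hab : a ^ 2 ≠ 4 * b)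
    {r s u v w : k} (hr : r ≠ 0) (h : s ^ 2 = r ^ 3 + a * r ^ 2 + b * r)
    (h₁ : u * r + v * s + w = 0) (h₂ : u * (b / r) + v * -(b * s / r ^ 2) + w = 0) :
    w ^ 3 - 2 * b ^ 2 * (u * v ^ 2) - b * (w * u ^ 2) + a * b * (w * v ^ 2) = 0 := by
  obtain rfl : w = -(u * r + v * s) := by linear_combination h₁
  have h₃ : u * (r * (b - r ^ 2)) = v * (s * (b + r ^ 2)) := by
    field_simp at h₂
    linear_combination h₂
  -- Both vanish only at a fixed point of the translation, and then `a² = 4b`.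
  have hne : r * (b - r ^ 2) ≠ 0 ∨ s * (b + r ^ 2) ≠ 0 := by
    by_contra! hc
    obtain ⟨hc1, hc2⟩ := hc
    have hrb : b = r ^ 2 := by
      have := (mul_eq_zero.1 hc1).resolve_left hr
      linear_combination this
    subst hrb
    have hs : s = 0 := by
      have h3 : 2 * r ^ 2 * s = 0 := by linear_combination hc2
      exact (mul_eq_zero.1 h3).resolve_left (mul_ne_zero h2 hb)
    subst hs
    have ha : a = -2 * r := by
      refine mul_left_cancel₀ hb ?_
      linear_combination -h
    exact hab (by rw [ha]; ring)
  obtain ⟨l, rfl, rfl⟩ : ∃ l, u = l * (s * (b + r ^ 2)) ∧ v = l * (r * (b - r ^ 2)) := by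
    rcases hne with hne | hne
    · exact ⟨v / (r * (b - r ^ 2)), by rw [div_mul_eq_mul_div, eq_div_iff hne, h₃],
        by rw [div_mul_cancel₀ _ hne]⟩
    · exact ⟨u / (s * (b + r ^ 2)), by rw [div_mul_cancel₀ _ hne],
        by rw [div_mul_eq_mul_div, eq_div_iff hne, h₃]⟩
  have hw : -(l * (s * (b + r ^ 2)) * r + l * (r * (b - r ^ 2)) * s) = -2 * b * r * s * l := by ring
  rw [hw]
  linear_combination 2 * b ^ 2 * r * s * l ^ 3 * (b - r ^ 2) ^ 2 * h

/-- Every point of the cubic of chords is such a chord. -/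
lemma exists_incident_of_chordCubic_eq_zero [IsAlgClosed k] (h2 : (2 : k) ≠ 0) (hb : b ≠ 0)
    {u v w : k} (hv : v ≠ 0)
    (h : w ^ 3 - 2 * b ^ 2 * (u * v ^ 2) - b * (w * u ^ 2) + a * b * (w * v ^ 2) = 0) :
    ∃ r s, r ≠ 0 ∧ s ^ 2 = r ^ 3 + a * r ^ 2 + b * r ∧ u * r + v * s + w = 0 ∧
      u * (b / r) + v * -(b * s / r ^ 2) + w = 0 := by
  obtain ⟨m, rfl⟩ : ∃ m, u = -(m * v) := ⟨-u / v, by field_simp⟩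
  obtain ⟨c, rfl⟩ : ∃ c, w = -(c * v) := ⟨-w / v, by field_simp⟩
  have h : c ^ 3 - 2 * b ^ 2 * m - b * c * m ^ 2 + a * b * c = 0 := by
    refine mul_left_cancel₀ (pow_ne_zero 3 hv) ?_
    linear_combination -h
  -- The line is now `y = m x + c`. If `c = 0` it is `y = 0`, and a root of `x² + a x + b` serves.
  by_cases hc : c = 0
  · subst hc
    have hm : m = 0 := by
      refine mul_left_cancel₀ (mul_ne_zero h2 (pow_ne_zero 2 hb)) ?_
      linear_combination -h
    subst hm
    obtain ⟨r, hr⟩ := IsAlgClosed.exists_root (Polynomial.C 1 * Polynomial.X ^ 2 +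
      Polynomial.C a * Polynomial.X + Polynomial.C b)
      (by rw [Polynomial.degree_quadratic one_ne_zero]; simp)
    simp at hr
    refine ⟨r, 0, ?_, by linear_combination -r * hr, by ring, by ring⟩
    rintro rfl
    exact hb (by linear_combination hr)
  -- The quadratic expresses that `(b/r, -b s/r²)` lies on the line when `s = m r + c`.
  · obtain ⟨r, hr⟩ := IsAlgClosed.exists_root (Polynomial.C c * Polynomial.X ^ 2 +
      Polynomial.C (2 * m * b) * Polynomial.X + Polynomial.C (b * c))
      (by rw [Polynomial.degree_quadratic hc]; simp)
    simp at hr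
    have hr0 : r ≠ 0 := by
      rintro rfl
      exact mul_ne_zero hb hc (by linear_combination hr)
    refine ⟨r, m * r + c, hr0, mul_left_cancel₀ (mul_ne_zero hb hc) ?_, by ring, ?_⟩
    · linear_combination -(b * r - c ^ 2) * hr - r ^ 2 * h
    · field_simp
      linear_combination -v * hr

lemma HasCoords.eq_coords {P : Points G} {r s r' s' : k} (h : HasCoords M P r s)
    (h' : HasCoords M P r' s') : r = r' ∧ s = s' :=
  ⟨mul_right_cancel₀ h.z_ne (h.x_eq.symm.trans h'.x_eq),
    mul_right_cancel₀ h.z_ne (h.y_eq.symm.trans h'.y_eq)⟩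

lemma IsInfinity.incident_iff (hW : IsWeierstrass G M a b c) {O : Points G} (hO : IsInfinity M O)
    (L : Plane k) : L.rep ⬝ᵥ O.vec = 0 ↔ dualCoords M L 1 = 0 := by
  rw [dotProduct_rep hW.det, hO.x_eq, hO.z_eq, mul_zero, mul_zero, zero_add, add_zero,
    mul_eq_zero, or_iff_left (hO.y_ne hW)]

lemma HasCoords.incident_iff (hW : IsWeierstrass G M a b c) {P : Points G} {r s : k}
    (hP : HasCoords M P r s) (L : Plane k) : L.rep ⬝ᵥ P.vec = 0 ↔
      dualCoords M L 0 * r + dualCoords M L 1 * s + dualCoords M L 2 = 0 := by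
  have h : L.rep ⬝ᵥ P.vec = (dualCoords M L 0 * r + dualCoords M L 1 * s + dualCoords M L 2) *
      eval P.vec (linForm (M 2)) := by
    rw [dotProduct_rep hW.det, hP.x_eq, hP.y_eq]
    ring
  rw [h, mul_eq_zero, or_iff_left hP.z_ne]

lemma ne_translate {β : Pic G} (hβ : β ≠ 0) {P : Points G}
    (ht : diffClass G P (translate β P) = β) : (P : Plane k) ≠ translate β P := fun h => by
  rw [← Subtype.ext h, diffClass_self] at ht
  exact hβ ht.symm

lemma mem_range_chordMap_iff [IsAlgClosed k] (h2 : (2 : k) ≠ 0) (hW : IsWeierstrass G M a b c)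
    {β : Pic G} (hβ : β ≠ 0) (hβ2 : (2 : ℕ) • β = 0) (ht : ∀ P, diffClass G P (translate β P) = β)
    (L : Plane k) : L ∈ Set.range (chordMap β) ↔
      ∃ P : Points G, L.rep ⬝ᵥ P.vec = 0 ∧ L.rep ⬝ᵥ (translate β P).vec = 0 := by
  have hsurj : Function.Surjective (quotientMap β) := Quotient.mk_surjective
  rw [← hsurj.range_comp]
  refine exists_congr fun P => ?_
  rw [Function.comp_apply, chordMap_quotientMap h2 hW hβ2, eq_comm,
    eq_lineThrough_iff (ne_translate hβ (ht P))]

/-- The image of the chord construction is a cubic in the dual plane. -/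
lemma IsWeierstrass.zeroLocus_chordCubic [IsAlgClosed k] (h2 : (2 : k) ≠ 0)
    (hW : IsWeierstrass G M a b 0) {O B : Points G} (hO : IsInfinity M O)
    (hB : HasCoords M B 0 0) (hβ : diffClass G O B ≠ 0) (hβ2 : (2 : ℕ) • diffClass G O B = 0) :
    zeroLocus (subst M⁻¹ᵀ (chordCubic a b)) = Set.range (chordMap (diffClass G O B)) := by
  obtain ⟨hb, hab⟩ := hW.coeff_ne h2
  have hcases := hW.translate_cases h2 hO hB hβ2
  ext L
  rw [mem_range_chordMap_iff h2 hW hβ hβ2 fun P => (hcases P).1]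
  change eval L.rep _ = 0 ↔ _
  rw [eval_subst, ← dualCoords, eval_chordCubic]
  constructor
  · intro h
    have haff (r s : k) (hr : r ≠ 0) (heq : s ^ 2 = r ^ 3 + a * r ^ 2 + b * r)
        (h₁ : dualCoords M L 0 * r + dualCoords M L 1 * s + dualCoords M L 2 = 0)
        (h₂ : dualCoords M L 0 * (b / r) + dualCoords M L 1 * -(b * s / r ^ 2) +
          dualCoords M L 2 = 0) :
        ∃ P : Points G, L.rep ⬝ᵥ P.vec = 0 ∧
          L.rep ⬝ᵥ (translate (diffClass G O B) P).vec = 0 := by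
      obtain ⟨P, hP⟩ := hW.exists_hasCoords (r := r) (s := s) (by linear_combination heq)
      obtain ⟨Q, hQ⟩ := hW.exists_hasCoords (r := b / r) (s := -(b * s / r ^ 2)) (by
        field_simp
        linear_combination b ^ 2 * heq)
      refine ⟨P, (hP.incident_iff hW L).2 h₁, ?_⟩
      rw [hW.translate_eq h2 (HasCoords.diffClass_translate hW hO hB hr hP hQ)]
      exact (hQ.incident_iff hW L).2 h₂
    by_cases hv : dualCoords M L 1 = 0
    · rw [hv] at h
      -- A line through `O`: either `x = 0`, the chord joining `O` and `B`, or `x = r` with `r² =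
      -- b`, where translation exchanges `(r, s)` and `(r, -s)`.
      by_cases hw : dualCoords M L 2 = 0
      · have hBO : translate (diffClass G O B) O = B := hW.translate_eq h2 rfl
        refine ⟨O, (hO.incident_iff hW L).2 hv, ?_⟩
        rw [hBO, hB.incident_iff hW L, hw]
        ring
      · have hwu : dualCoords M L 2 ^ 2 = b * dualCoords M L 0 ^ 2 := by
          refine mul_left_cancel₀ hw ?_
          linear_combination h
        have hu : dualCoords M L 0 ≠ 0 := by
          intro hu
          rw [hu] at hwu
          exact hw (pow_eq_zero_iff (n := 2) (by norm_num) |>.1 (by linear_combination hwu))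
        obtain ⟨r, hr⟩ : ∃ r, dualCoords M L 2 = -(dualCoords M L 0 * r) :=
          ⟨-dualCoords M L 2 / dualCoords M L 0, by field_simp⟩
        have hrb : b = r ^ 2 := by
          refine mul_right_cancel₀ (pow_ne_zero 2 hu) ?_
          rw [hr] at hwu
          linear_combination -hwu
        have hr0 : r ≠ 0 := by
          rintro rfl
          exact hb (by rw [hrb]; ring)
        obtain ⟨s, hs⟩ := IsAlgClosed.exists_pow_nat_eq (r ^ 3 + a * r ^ 2 + b * r) two_pos
        refine haff r s hr0 hs ?_ ?_
        · rw [hv, hr]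
          ring
        · rw [hv, hr, hrb]
          field_simp
          ring
    · obtain ⟨r, s, hr, heq, h₁, h₂⟩ := exists_incident_of_chordCubic_eq_zero h2 hb hv h
      exact haff r s hr heq h₁ h₂
  · rintro ⟨P, h₁, h₂⟩
    rcases (hcases P).2 with ⟨hP, hQ⟩ | ⟨hP, hQ⟩ | ⟨r, s, hr, hP, hQ⟩
    · rw [hP, hO.incident_iff hW] at h₁
      rw [hQ, hB.incident_iff hW] at h₂
      have hw : dualCoords M L 2 = 0 := by linear_combination h₂
      rw [h₁, hw]
      ring
    · rw [hP, hB.incident_iff hW] at h₁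
      rw [hQ, hO.incident_iff hW] at h₂
      have hw : dualCoords M L 2 = 0 := by linear_combination h₁
      rw [h₂, hw]
      ring
    · rw [hP.incident_iff hW] at h₁
      rw [hQ.incident_iff hW] at h₂
      exact chordCubic_eq_zero_of_incident h2 hb hab hr (by linear_combination hP.equation hW) h₁ h₂

/-- The points of the dual curve whose tangent line is spanned by `(0, 1, 0)` and `(a, 0, 2b)`. -/
lemma isFlex_chordCubic [IsAlgClosed k] (h2 : (2 : k) ≠ 0) (hM : IsUnit M.det) (hb : b ≠ 0)
    (hab : a ^ 2 ≠ 4 * b) {L : Plane k} (h0 : dualCoords M L 0 = 0) (hw : dualCoords M L 2 = 0) :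
    IsFlex (subst M⁻¹ᵀ (chordCubic a b)) L := by
  have hL : Vanishes (subst M⁻¹ᵀ (chordCubic a b)) L := by
    rw [Vanishes, eval_subst, ← dualCoords, eval_chordCubic, h0, hw]
    ring
  have h2b : 2 * b ≠ 0 := mul_ne_zero h2 hb
  obtain ⟨Q, μ, hμ, hQ⟩ := exists_dualCoords hM (w := ![a, 0, 2 * b])
    (fun h => h2b (by simpa using congrFun h 2))
  refine ⟨hL, ((chordCubic_isSmoothCubic h2 hb hab).subst (det_inv_transpose hM)).smooth _
    L.rep_nonzero hL, Q, ?_, ?_⟩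
  · rintro rfl
    rw [hQ] at hw
    exact mul_ne_zero hμ h2b (by simpa using hw)
  · rw [restrictToLine_subst, ← dualCoords, ← dualCoords]
    -- With `L = (0, v, 0)` and `Q = μ (a, 0, 2b)`, the terms linear in the parameter cancel and
    -- only the cubic ones remain.
    refine ⟨Polynomial.C (μ ^ 3 * ((2 * b) ^ 3 - 2 * a ^ 2 * b ^ 2)), ?_⟩
    simp [chordCubic, h0, hw, hQ]
    ring

/-- The chord through the images of a point of order two on the quotient curve. -/
lemma IsWeierstrass.isFlex_chordMap [IsAlgClosed k] (h2 : (2 : k) ≠ 0)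
    (hW : IsWeierstrass G M a b 0) {O B : Points G} (hO : IsInfinity M O)
    (hB : HasCoords M B 0 0) (hβ : diffClass G O B ≠ 0) (hβ2 : (2 : ℕ) • diffClass G O B = 0)
    {T : Points G} (hT : (2 : ℕ) • diffClass G O T = 0)
    (hT' : diffClass G O T ∉ AddSubgroup.zmultiples (diffClass G O B)) :
    IsFlex (subst M⁻¹ᵀ (chordCubic a b))
      (chordMap (diffClass G O B) (quotientMap (diffClass G O B) T)) := by
  obtain ⟨hb, hab⟩ := hW.coeff_ne h2
  have hTO : T ≠ O := by
    rintro rfl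
    rw [diffClass_self] at hT'
    exact hT' (zero_mem _)
  have hTB : T ≠ B := by
    rintro rfl
    exact hT' (AddSubgroup.mem_zmultiples _)
  obtain ⟨S, hS, hS'⟩ := hO.exists_two_torsion h2 hW hT
  obtain rfl := hW.diffClass_injective h2 hS
  obtain ⟨t, hTt⟩ := hS'.resolve_left hTO
  obtain ⟨ht, h⟩ := hW.translate_cases h2 hO hB hβ2 T
  obtain ⟨r, s, hr, hTr, hQ⟩ := (h.resolve_left fun h => hTO h.1).resolve_left fun h => hTB h.1
  obtain ⟨rfl, rfl⟩ := hTt.eq_coords hTr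
  have hne := ne_translate hβ ht
  have hbt : b / t - t ≠ 0 := fun h => by
    rw [sub_eq_zero.1 h, mul_zero, zero_div, neg_zero] at hQ
    exact hne (congrArg Subtype.val (hTt.eq hW hQ))
  rw [chordMap_quotientMap h2 hW hβ2]
  obtain ⟨h₁, h₂⟩ := (eq_lineThrough_iff hne).1 rfl
  replace h₁ := (hTt.incident_iff hW _).1 h₁
  replace h₂ := (hQ.incident_iff hW _).1 h₂
  -- `T = (t, 0)` and its translate `(b/t, 0)` both lie on the chord; subtracting the incidences
  -- gives `U (b/t - t) = 0`.
  have h0 : dualCoords M (lineThrough (T : Plane k) (translate (diffClass G O B) T)) 0 = 0 := by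
    refine (mul_eq_zero.1 ?_).resolve_right hbt
    linear_combination h₂ - h₁
  refine isFlex_chordCubic h2 hW.det hb hab h0 ?_
  rw [h0] at h₁
  linear_combination h₁

/-- A translate of `π(O)` by a class of order two is the image of a point of order two. -/
lemma exists_quotientTranslate_eq {β γ : Pic G} (hβ : (2 : ℕ) • β = 0) (hγ : (2 : ℕ) • γ = 0)
    (hγ0 : pushforward β γ ≠ 0) {O C : Points G} (hC : γ = diffClass G O C) :
    ∃ T : Points G, quotientTranslate β (pushforward β γ) (quotientMap β O) = quotientMap β T ∧
      (2 : ℕ) • diffClass G O T = 0 ∧ diffClass G O T ∉ AddSubgroup.zmultiples β := by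
  have hex : ∃ y : QuotientCurve β, ∃ p q : Points G, quotientMap β p = quotientMap β O ∧
      quotientMap β q = y ∧ pushforward β (diffClass G p q) = pushforward β γ :=
    ⟨quotientMap β C, O, C, rfl, rfl, by rw [hC]⟩
  rw [quotientTranslate, dif_pos hex]
  -- The chosen `p` only represents `π(O)`, so `[T] - [O]` agrees with `γ` up to a multiple of `β`,
  -- which doubling kills.
  obtain ⟨p, T, hp, hT, h⟩ := hex.choose_spec
  have hp : diffClass G O p ∈ AddSubgroup.zmultiples β := Quotient.exact hp.symm
  have hmem : diffClass G O T - γ ∈ AddSubgroup.zmultiples β := by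
    have : diffClass G p T - γ ∈ AddSubgroup.zmultiples β := by
      rw [← neg_mem_iff, neg_sub, sub_eq_neg_add]
      exact QuotientAddGroup.eq.1 h
    rw [← diffClass_add G O p T, add_sub_assoc]
    exact add_mem hp this
  refine ⟨T, hT.symm, ?_, fun h => hγ0 ((QuotientAddGroup.eq_zero_iff γ).2 ?_)⟩
  · obtain ⟨n, hn⟩ := hmem
    have hn : n • β = diffClass G O T - γ := hn
    rw [← sub_add_cancel (diffClass G O T) γ, ← hn, nsmul_add, hγ, smul_comm, hβ, smul_zero,
      add_zero]
  · have := sub_mem h hmem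
    rwa [sub_sub_cancel] at this

end

end ChordConstruction

/-! ### The flex as origin: proof of the theorem -/

theorem mainTheorem2 {k : Type*} [Field k] [IsAlgClosed k] (h2 : (2 : k) ≠ 0)
    (G : MvPolynomial (Fin 3) k) (hG : ChordConstruction.IsSmoothCubic G)
    (β : ChordConstruction.Pic G) (hβ : β ≠ 0) (hβ2 : (2 : ℕ) • β = 0)
    (β' : ChordConstruction.PicQuotient β) (hβ' : β' ≠ 0)
    (hβ'2 : ∃ γ : ChordConstruction.Pic G,
      (2 : ℕ) • γ = 0 ∧ ChordConstruction.pushforward β γ = β')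
    (p : ChordConstruction.Points G)
    (hp : ChordConstruction.IsFlex G (p : ChordConstruction.Plane k)) :
    ∃ G' : MvPolynomial (Fin 3) k,
      ChordConstruction.IsSmoothCubic G' ∧
      ChordConstruction.zeroLocus G' = Set.range (ChordConstruction.chordMap β) ∧
      ChordConstruction.IsFlex G' (ChordConstruction.chordMap β
        (ChordConstruction.quotientTranslate β β' (ChordConstruction.quotientMap β p))) := by
  obtain ⟨M, a, b, c, hM, hGM, hx, hz⟩ := ChordConstruction.exists_weierstrass h2 hG hp
  have hW : ChordConstruction.IsWeierstrass G M a b c := ⟨hM, hGM, hG⟩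
  have hO : ChordConstruction.IsInfinity M p :=
    ⟨by rw [ChordConstruction.eval_linForm]; exact hx,
      by rw [ChordConstruction.eval_linForm]; exact hz⟩
  obtain ⟨B, rfl, hB⟩ := hO.exists_two_torsion h2 hW hβ2
  have hBp : B ≠ p := by
    rintro rfl
    exact hβ (ChordConstruction.diffClass_self G B)
  obtain ⟨r, hB⟩ := hB.resolve_left hBp
  obtain ⟨M', a', b', hW', hO', hB'⟩ := hW.exists_shift hO hB
  obtain ⟨hb, hab⟩ := hW'.coeff_ne h2
  obtain ⟨γ, hγ, rfl⟩ := hβ'2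
  -- The point `C` shows that the translate of `π(p)` exists, which excludes the default value of
  -- `quotientTranslate`.
  obtain ⟨C, hC, -⟩ := hO.exists_two_torsion h2 hW hγ
  obtain ⟨T, hT, hT2, hTβ⟩ := ChordConstruction.exists_quotientTranslate_eq hβ2 hγ hβ' hC
  refine ⟨_, (ChordConstruction.chordCubic_isSmoothCubic h2 hb hab).subst
    (ChordConstruction.det_inv_transpose hW'.det),
    hW'.zeroLocus_chordCubic h2 hO' hB' hβ hβ2, ?_⟩
  rw [hT]
  exact hW'.isFlex_chordMap h2 hO' hB' hβ hβ2 hT2 hTβ
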